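/- Let $k\ge 1$ and $2k\le n\le \binom{k+1}{2}+1$. For a field $K$ let $\mathrm{Gr}_K(k,n)$ be the Grassmannian of $k$-dimensional subspaces of $K^n$ and $\mathrm{Gr}_K(k,n)^\circ$ the very affine variety of subspaces all of whose Plücker coordinates are nonzero. For $\lambda\in(K^*)^n$ let $\mathrm{OGr}^\lambda_K(k,n)$ be the set of $V\in\mathrm{Gr}_K(k,n)$ with $\sum_i\lambda_ix_iy_i=0$ for all $x,y\in V$, and let $\mathrm{OGr}^\lambda_K(k,n)^\circ=\mathrm{OGr}^\lambda_K(k,n)\cap\mathrm{Gr}_K(k,n)^\circ$. Let $\mathrm{SGr}_K(k,n)$ be the Zariski closure in $\mathrm{Gr}_K(k,n)$ of $\bigcup_{\lambda\in(K^*)^n}\mathrm{OGr}^\lambda_K(k,n)$, and let $X_K(k,n)^{\mathrm{sd}}=\mathrm{SGr}_K(k,n)^\circ/(K^*)^n$ inside $X_K(k,n)=\mathrm{Gr}_K(k,n)^\circ/(K^*)^n$, where $\mathrm{SGr}_K(k,n)^\circ=\mathrm{SGr}_K(k,n)\cap\mathrm{Gr}_K(k,n)^\circ$ and $(K^*)^n$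 acts by rescaling coordinates. (a) Let $K$ be algebraically closed with $\operatorname{char}K\neq 2$, and let $\mathbf 1=(1,\dots,1)$. There are nonempty Zariski dense (principal) open subsets $U\subseteq\mathrm{OGr}^{\mathbf 1}_K(k,n)^\circ$ and $W\subseteq X_K(k,n)^{\mathrm{sd}}$ such that $V\mapsto[V]$ (the torus orbit of $V$) restricts to a dominant finite morphism $U\to W$, all of whose fibers consist of exactly $2^{n-1}$ points. (b) Over $\mathbb R$, there are nonempty Zariski dense (principal) open subsets $U\subseteq\bigcup_{u\in\{1\}\times\{\pm1\}^{n-1}}\mathrm{OGr}^u_{\mathbb R}(k,n)^\circ$ and $W\subseteq X_{\mathbb R}(k,n)^{\mathrm{sd}}$ such that $V\mapsto[V]$ restricts to a dominant finite map $U\to W$, all of whose fibers consist of exactly $2^{n-1}$ points. Here varieties over $\mathbb R$ are sets of real points with the algebra of functions induced by polynomials in the ratios of Plücker coordinates, with $1/g$ adjoined on a principal open subset $\{g\ne0\}$, and a map is finite if it makes the coordinate ring of the source a finite module over that of the target. -/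

import Mathlib

noncomputable section

namespace SelfProj

/-! ### Affine varieties given by a set of points and its algebra of regular functions -/

section Affine

variable {K : Type*} [Field K] {Y Z : Type*}

/-- Pullback of functions along a map of point sets. -/
def pullback (f : Y → Z) : (Z → K) →ₐ[K] (Y → K) where
  toFun b := b ∘ f
  map_one' := rfl
  map_mul' _ _ := rfl
  map_zero' := rfl
  map_add' _ _ := rfl
  commutes' _ := rfl

/-- The coordinate ring of a (closed) subset `S`: the restrictions to `S` of the regular
functions. -/
def restrictRing (A : Subalgebra K (Z → K)) (S : Set Z) : Subalgebra K (S → K) :=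
  A.map (pullback (Subtype.val : S → Z))

/-- The points of the principal open subset `D(g)`. -/
abbrev basicOpen (g : Z → K) : Set Z := {z | g z ≠ 0}

/-- The coordinate ring of the principal open subset `D(g)`, which is the affine variety with
coordinate ring `A[1/g]`: it is generated by the restrictions of the regular functions and by
`1/g`. -/
def basicOpenRing (A : Subalgebra K (Z → K)) (g : Z → K) : Subalgebra K (basicOpen g → K) :=
  restrictRing A (basicOpen g) ⊔ Algebra.adjoin K ({fun z => (g z.1)⁻¹} : Set (basicOpen g → K))

/-- A set of points is Zariski dense if every regular function vanishing on it is zero. -/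
def ZariskiDense (A : Subalgebra K (Z → K)) (S : Set Z) : Prop :=
  ∀ a ∈ A, (∀ z ∈ S, a z = 0) → ∀ z, a z = 0

/-- A map of affine varieties is dominant if its image is Zariski dense. -/
def IsDominantMap (B : Subalgebra K (Z → K)) (f : Y → Z) : Prop :=
  ZariskiDense B (Set.range f)

/-- A finite morphism of affine varieties: regular functions pull back to regular functions, and
the coordinate ring of the source becomes a finite module over the coordinate ring of the
target. -/
def IsFiniteMap (A : Subalgebra K (Y → K)) (B : Subalgebra K (Z → K)) (f : Y → Z) : Prop :=
  ∃ hf : ∀ b ∈ B, pullback f b ∈ A,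
    (((pullback f).comp B.val).codRestrict A (fun b => hf b b.2) : B →ₐ[K] A).Finite

/-- The map `φ` restricts to a dominant finite map, all of whose fibers consist of exactly `d`
points, between Zariski dense nonempty (principal) open subsets `D(g)` of `Y` and `D(h)` of `Z`. -/
def DominantFiniteOnOpens (A : Subalgebra K (Y → K)) (B : Subalgebra K (Z → K)) (φ : Y → Z)
    (d : ℕ) : Prop :=
  ∃ g ∈ A, ∃ h ∈ B,
    ZariskiDense A (basicOpen g) ∧ ZariskiDense B (basicOpen h) ∧
    (basicOpen g).Nonempty ∧ (basicOpen h).Nonempty ∧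
    ∃ hφ : Set.MapsTo φ (basicOpen g) (basicOpen h),
      IsFiniteMap (basicOpenRing A g) (basicOpenRing B h) (hφ.restrict φ _ _) ∧
      IsDominantMap (basicOpenRing B h) (hφ.restrict φ _ _) ∧
      ∀ x : basicOpen h, {v : basicOpen g | hφ.restrict φ _ _ v = x}.ncard = d

end Affine

/-! ### Grassmannians -/

section Grassmannian

variable (K : Type*) [Field K] (k n : ℕ)

/-- The points of the Grassmannian `Gr(k,n)`: `k`-dimensional subspaces of `K^n`. -/
abbrev Gr : Type _ := {V : Submodule K (Fin n → K) // Module.finrank K V = k}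

variable {K k n}

/-- The `k × n` matrix whose rows are a given basis of `V`. -/
def rowMatrix {V : Submodule K (Fin n → K)} (b : Module.Basis (Fin k) K V) :
    Matrix (Fin k) (Fin n) K :=
  Matrix.of fun a j => (b a : Fin n → K) j

/-- The vector `(q_I(V))_I` of maximal minors of a `k × n` matrix with row span `V`. The index set
consists of the increasing maps `I : [k] → [n]`, that is, of the `k`-subsets of `[n]`. The matrix
is chosen; another choice rescales the vector by a nonzero constant, and only
rescaling-invariant expressions are used below. -/
def plucker (V : Gr K k n) (I : Fin k ↪o Fin n) : K :=
  ((rowMatrix (Module.finBasisOfFinrankEq K V.1 V.2)).submatrix id I).det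

theorem plucker_unique (V : Gr K k n) (b : Module.Basis (Fin k) K V.1) :
    ∃ c : Kˣ, ∀ I : Fin k ↪o Fin n, ((rowMatrix b).submatrix id I).det = c * plucker V I := by
  set b' := Module.finBasisOfFinrankEq K V.1 V.2 with hb'
  have hu : IsUnit (b'.toMatrix b).transpose.det := by
    rw [Matrix.det_transpose, ← Module.Basis.det_apply]
    exact b'.isUnit_det b
  refine ⟨hu.unit, fun I => ?_⟩
  have : (rowMatrix b).submatrix id I =
      (b'.toMatrix b).transpose * (rowMatrix b').submatrix id I := by
    ext a j
    have h := congrArg (fun v : V.1 => (v : Fin n → K) (I j)) (b'.sum_toMatrix_smul_self b a)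
    simp only [Submodule.coe_sum, Submodule.coe_smul, Finset.sum_apply, Pi.smul_apply,
      smul_eq_mul] at h
    simp only [Matrix.submatrix_apply, id, rowMatrix, Matrix.of_apply, Matrix.mul_apply,
      Matrix.transpose_apply]
    exact h.symm
  rw [this, Matrix.det_mul]
  rfl

/-- The Zariski closure of a subset of `Gr(k,n)` in the Plücker embedding. -/
def zariskiClosure (S : Set (Gr K k n)) : Set (Gr K k n) :=
  {V | ∀ (d : ℕ) (F : MvPolynomial (Fin k ↪o Fin n) K), F.IsHomogeneous d →
    (∀ W ∈ S, MvPolynomial.eval (plucker W) F = 0) → MvPolynomial.eval (plucker V) F = 0}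

/-- The orthogonal Grassmannian `OGr^l(k,n)`: subspaces which are isotropic for the diagonal form
`η_l(x,y) = ∑ l_i x_i y_i`, where all `l_i` are nonzero. -/
def OGr (l : Fin n → Kˣ) : Set (Gr K k n) :=
  {V | ∀ x ∈ V.1, ∀ y ∈ V.1, ∑ i, (l i : K) * x i * y i = 0}

variable (K k n)

/-- The set of self-projecting subspaces: those `V` with `V · diag(l) · Vᵗ = 0` for some `l` in the
torus. -/
def selfProjecting : Set (Gr K k n) := {V | ∃ l : Fin n → Kˣ, V ∈ OGr l}

/-- The self-projecting Grassmannian `SGr(k,n)`. -/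
def SGr : Set (Gr K k n) := zariskiClosure (selfProjecting K k n)

/-- `Gr(k,n)°`: the subspaces all of whose Plücker coordinates are nonzero. -/
abbrev GrOpen : Type _ := {V : Gr K k n // ∀ I, plucker V I ≠ 0}

/-- The coordinate ring of the very affine variety `Gr(k,n)°`, generated by the ratios of Plücker
coordinates. -/
def grRing : Subalgebra K (GrOpen K k n → K) :=
  Algebra.adjoin K (Set.range fun (p : (Fin k ↪o Fin n) × (Fin k ↪o Fin n)) (V : GrOpen K k n) =>
    plucker V.1 p.1 / plucker V.1 p.2)

variable {K n}

/-- The action of the torus `(K^*)^n` on `K^n` by rescaling coordinates. -/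
def torusScale (t : Fin n → Kˣ) : (Fin n → K) →ₗ[K] (Fin n → K) where
  toFun x i := (t i : K) * x i
  map_add' x y := by ext i; simp [mul_add]
  map_smul' c x := by ext i; simp [mul_left_comm]

variable (K n)

/-- Two points of `Gr(k,n)°` are equivalent if they lie in the same orbit of the torus. -/
def torusSetoid : Setoid (GrOpen K k n) where
  r V W := ∃ t : Fin n → Kˣ, W.1.1 = V.1.1.map (torusScale t)
  iseqv := by
    refine ⟨fun V => ⟨1, ?_⟩, ?_, ?_⟩
    · have : torusScale (1 : Fin n → Kˣ) = LinearMap.id := by ext x i; simp [torusScale]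
      rw [this, Submodule.map_id]
    · rintro V W ⟨t, ht⟩
      refine ⟨t⁻¹, ?_⟩
      have : torusScale t⁻¹ ∘ₗ torusScale t = LinearMap.id := by
        refine LinearMap.ext fun x => funext fun i => ?_
        simp [torusScale]
      rw [ht, ← Submodule.map_comp, this, Submodule.map_id]
    · rintro V W U ⟨t, ht⟩ ⟨s, hs⟩
      refine ⟨s * t, ?_⟩
      have : torusScale (s * t) = torusScale s ∘ₗ torusScale t := by
        refine LinearMap.ext fun x => funext fun i => ?_
        simp [torusScale, mul_assoc]
      rw [hs, ht, ← Submodule.map_comp, this]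

/-- The points of `X(k,n) = Gr(k,n)° / (K^*)^n`. -/
abbrev X : Type _ := Quotient (torusSetoid K k n)

variable {K k n} in
/-- The class of a point of `Gr(k,n)°` in `X(k,n)`. -/
def toX (V : GrOpen K k n) : X K k n := Quotient.mk (torusSetoid K k n) V

/-- The coordinate ring of `X(k,n)`: the torus-invariant regular functions on `Gr(k,n)°`. -/
def xRing : Subalgebra K (X K k n → K) := (grRing K k n).comap (pullback toX)

/-- The self-projecting configuration space `X(k,n)^sd = SGr(k,n)° / (K^*)^n` inside `X(k,n)`. -/
def Xsd : Set (X K k n) := toX '' {V | V.1 ∈ SGr K k n}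

/-- The coordinate ring of the subvariety `X(k,n)^sd` of `X(k,n)`. -/
def xsdRing : Subalgebra K (Xsd K k n → K) := restrictRing (xRing K k n) (Xsd K k n)

variable {K n}

/-- The union of the very affine orthogonal Grassmannians `OGr^l(k,n)°` over all `l ∈ L`. -/
def ogrOpen (L : Set (Fin n → Kˣ)) : Set (GrOpen K k n) := {V | ∃ l ∈ L, V.1 ∈ OGr l}

/-- The coordinate ring of the union of the `OGr^l(k,n)°`, `l ∈ L`, as a subvariety of
`Gr(k,n)°`. -/
def ogrRing (L : Set (Fin n → Kˣ)) : Subalgebra K (ogrOpen k L → K) :=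
  restrictRing (grRing K k n) (ogrOpen k L)

/-- The map sending an isotropic subspace to its torus orbit. -/
def ogrToXsd (L : Set (Fin n → Kˣ)) (V : ogrOpen k L) : Xsd K k n :=
  ⟨toX V.1, V.1, fun _ _ _ hF => hF _ (V.2.imp fun _ h => h.2), rfl⟩

variable (n)

/-- The set `{1} × {±1}^(n-1)` of sign vectors with first entry `1`. -/
def signVectors : Set (Fin n → ℝˣ) :=
  {u | (∀ i, u i = 1 ∨ u i = -1) ∧ ∀ i : Fin n, (i : ℕ) = 0 → u i = 1}

end Grassmannian

end SelfProj

end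

/-! Rescaling coordinates by `t` divides the coefficients of a diagonal form vanishing on `V` by
`t_i ^ 2`. Suppose the forms vanishing on `V` are the multiples of a single one, with all
coefficients nonzero. Moving `V` within its torus orbit to a representative form (`1`, or a sign
vector over the reals) then fixes every `t_i ^ 2` up to a common factor. Hence `t` is determined up
to signs and a common scalar, and scalars act trivially on subspaces: `2 ^ (n - 1)` points remain
(`exists_image_scale_eq`, `ncard_signs`). They are told apart by a section of the torus quotient
(`Normalization`), which splits a point into a matrix depending only on its orbit and scaling
factors.

Uniqueness of the form is certified by nonvanishing cofactors of `n` of the linear conditions on it,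
and these cofactors are torus-invariant. They satisfy all the conditions on self-projecting
subspaces, hence on the closure `SGr`, so a point of `SGr` with nonzero Plücker coordinates and
nonzero `discriminant` is itself self-projecting, with a unique form. On the source the squared
scaling factors are, up to sign, ratios of cofactors. Fourth powers of the generators therefore come
from the target, which gives finiteness (`scale_pow_four`, `isFiniteMap_of_pow`).

Density has two ingredients. Irreducibility is replaced by polynomial curves joining two isotropic
subspaces after a change of signs, which changes neither the form nor the torus orbit
(`exists_isotropic_curve`). It also takes one isotropic subspace with unique form for each relevant
`u`. Its matrix has as columns `n` vectors of `K ^ k` whose squares satisfy exactly one linear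
relation, with coefficients `u`. Two rescaled orthonormal bases give `2k` such vectors, and one more
can be added as long as their number is at most `(k + 1).choose 2`, the dimension of the symmetric
matrices; this gives the upper bound on `n` (`exists_isSelfDualConfiguration_insert`). -/

noncomputable section
namespace SelfProj

/-! ### Determinants of matrices of functions -/

section FunctionRing

variable {K : Type*} [Field K] {Y : Type*}

theorem det_mem (S : Subalgebra K (Y → K)) {m : Type*} [Fintype m] [DecidableEq m]
    (M : Y → Matrix m m K) (h : ∀ i j, (fun y => M y i j) ∈ S) : (fun y => (M y).det) ∈ S := by
  have : (fun y => (M y).det) =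
      ∑ σ : Equiv.Perm m, (Equiv.Perm.sign σ : ℤ) • ∏ i, (fun y => M y (σ i) i) := by
    funext y
    simp [Matrix.det_apply, Finset.sum_apply, Finset.prod_apply, Units.smul_def]
  rw [this]
  exact S.sum_mem fun σ _ => S.zsmul_mem (S.prod_mem fun i _ => h _ _) _

theorem adjugate_mem (S : Subalgebra K (Y → K)) {m : Type*} [Fintype m] [DecidableEq m]
    (M : Y → Matrix m m K) (h : ∀ i j, (fun y => M y i j) ∈ S) (i j : m) :
    (fun y => (M y).adjugate i j) ∈ S := by
  simp only [Matrix.adjugate_apply]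
  refine det_mem S _ fun a b => ?_
  by_cases ha : a = j
  · subst ha
    simp only [Matrix.updateRow_self]
    exact S.algebraMap_mem (Pi.single (M := fun _ => K) i 1 b)
  · simpa [Matrix.updateRow_ne ha] using h a b

theorem mvPolynomial_eval_mem (S : Subalgebra K (Y → K)) {σ : Type*} (F : MvPolynomial σ K)
    (f : Y → σ → K) (h : ∀ i, (fun y => f y i) ∈ S) : (fun y => MvPolynomial.eval (f y) F) ∈ S := by
  induction F using MvPolynomial.induction_on with
  | C a =>
    simp only [MvPolynomial.eval_C]
    exact S.algebraMap_mem a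
  | add p q hp hq =>
    simp only [map_add]
    exact S.add_mem hp hq
  | mul_X p i hp =>
    simp only [map_mul, MvPolynomial.eval_X]
    exact S.mul_mem hp (h i)

variable (K) in
/-- The functions on the line given by polynomials. -/
def polyFun : Subalgebra K (K → K) :=
  (Polynomial.aeval (R := K) (id : K → K)).range

theorem mem_polyFun {f : K → K} : f ∈ polyFun K ↔ ∃ p : Polynomial K, ∀ t, f t = p.eval t := by
  have key : ∀ (p : Polynomial K) (t : K), (Polynomial.aeval (id : K → K) p) t = p.eval t := by
    intro p t
    induction p using Polynomial.induction_on' with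
    | add p q hp hq => rw [map_add, Pi.add_apply, hp, hq, Polynomial.eval_add]
    | monomial n a => simp [Polynomial.aeval_monomial]
  constructor
  · rintro ⟨p, rfl⟩
    exact ⟨p, fun t => key p t⟩
  · rintro ⟨p, hp⟩
    exact ⟨p, funext fun t => (key p t).trans (hp t).symm⟩

theorem id_mem_polyFun : (fun t : K => t) ∈ polyFun K := mem_polyFun.2 ⟨Polynomial.X, by simp⟩

theorem const_mem_polyFun (c : K) : (fun _ : K => c) ∈ polyFun K := (polyFun K).algebraMap_mem c

/-- Polynomials over an infinite field form a domain of functions. Along a curve, open conditions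
that hold at different parameters thus hold at a common one. -/
theorem mul_ne_zero_of_mem_polyFun [Infinite K] {f g : K → K} (hf : f ∈ polyFun K)
    (hg : g ∈ polyFun K) {t₀ t₁ : K} (h₀ : f t₀ ≠ 0) (h₁ : g t₁ ≠ 0) :
    f * g ∈ polyFun K ∧ ∃ t, (f * g) t ≠ 0 := by
  refine ⟨mul_mem hf hg, ?_⟩
  obtain ⟨p, hp⟩ := mem_polyFun.1 hf
  obtain ⟨q, hq⟩ := mem_polyFun.1 hg
  by_contra! hz
  have : p * q = 0 := Polynomial.funext fun t => by
    rw [Polynomial.eval_mul, ← hp, ← hq]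
    simpa using hz t
  rcases mul_eq_zero.1 this with rfl | rfl
  · exact h₀ (by simp [hp])
  · exact h₁ (by simp [hq])

end FunctionRing

/-! ### Isotropic matrices for diagonal forms -/

section Isotropic

variable {K : Type*} [Field K] {k n : ℕ}

/-- The maximal minor of `X` with columns `f`. -/
def minor (X : Matrix (Fin k) (Fin n) K) (f : Fin k → Fin n) : K := (X.submatrix id f).det

/-- The subspace spanned by the rows of `X`. -/
def rowSpan (X : Matrix (Fin k) (Fin n) K) : Submodule K (Fin n → K) :=
  Submodule.span K (Set.range X.row)

/-- The diagonal form with coefficients `x` vanishes on the subspace `V`. -/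
def Isotropic (x : Fin n → K) (V : Submodule K (Fin n → K)) : Prop :=
  ∀ v ∈ V, ∀ w ∈ V, ∑ i, x i * v i * w i = 0

theorem isotropic_rowSpan_iff {x : Fin n → K} {X : Matrix (Fin k) (Fin n) K} :
    Isotropic x (rowSpan X) ↔ ∀ a b, ∑ i, x i * X a i * X b i = 0 := by
  constructor
  · intro h a b
    exact h _ (Submodule.subset_span ⟨a, rfl⟩) _ (Submodule.subset_span ⟨b, rfl⟩)
  · intro h v hv w hw
    induction hv, hw using Submodule.span_induction₂ with
    | mem_mem v w hv hw =>
      obtain ⟨a, rfl⟩ := hv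
      obtain ⟨b, rfl⟩ := hw
      exact h a b
    | zero_left => simp
    | zero_right => simp
    | add_left x y z _ _ _ h1 h2 => simp [mul_add, add_mul, Finset.sum_add_distrib, h1, h2]
    | add_right x y z _ _ _ h1 h2 => simp [mul_add, Finset.sum_add_distrib, h1, h2]
    | smul_left r x y _ _ h1 =>
      have : ∀ i, ∀ c : K, c * (r • x) i * y i = r * (c * x i * y i) := by
        intro i c; simp; ring
      simp only [this, ← Finset.mul_sum, h1, mul_zero]
    | smul_right r x y _ _ h1 =>
      have : ∀ i, ∀ c : K, c * x i * (r • y) i = r * (c * x i * y i) := by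
        intro i c; simp; ring
      simp only [this, ← Finset.mul_sum, h1, mul_zero]

theorem mul_diagonal_mul_transpose_apply (X Y : Matrix (Fin k) (Fin n) K) (d : Fin n → K)
    (a b : Fin k) :
    (X * Matrix.diagonal d * Y.transpose) a b = ∑ i, X a i * d i * Y b i := by
  rw [Matrix.mul_apply]
  simp only [Matrix.mul_diagonal, Matrix.transpose_apply]

theorem isotropic_rowSpan_iff_mul {x : Fin n → K} {X : Matrix (Fin k) (Fin n) K} :
    Isotropic x (rowSpan X) ↔ X * Matrix.diagonal x * X.transpose = 0 := by
  rw [isotropic_rowSpan_iff, ← Matrix.ext_iff]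
  refine forall₂_congr fun a b => ?_
  simp only [mul_diagonal_mul_transpose_apply, Matrix.zero_apply, mul_comm (X a _)]

/-- The torus acts on forms through squares; this is the source of the sign ambiguity and of the
degree of the map. -/
theorem isotropic_map_torusScale {x : Fin n → K} {V : Submodule K (Fin n → K)} (t : Fin n → Kˣ) :
    Isotropic x (V.map (torusScale t)) ↔ Isotropic (fun i => x i * (t i : K) ^ 2) V := by
  simp only [Isotropic, Submodule.mem_map, forall_exists_index, and_imp,
    forall_apply_eq_imp_iff₂]
  refine forall₄_congr fun v _ w _ => ?_
  have : ∀ i, x i * torusScale t v i * torusScale t w i = x i * (t i : K) ^ 2 * v i * w i := by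
    intro i; simp [torusScale]; ring
  simp only [this]

theorem rowSpan_mul_le (M : Matrix (Fin k) (Fin k) K) (X : Matrix (Fin k) (Fin n) K) :
    rowSpan (M * X) ≤ rowSpan X := by
  rw [rowSpan, Submodule.span_le]
  rintro _ ⟨a, rfl⟩
  have : (M * X).row a = ∑ b, M a b • X.row b := by
    ext i; simp [Matrix.mul_apply]
  rw [this]
  exact Submodule.sum_mem _ fun b _ => Submodule.smul_mem _ _ (Submodule.subset_span ⟨b, rfl⟩)

theorem rowSpan_mul {M : Matrix (Fin k) (Fin k) K} (hM : M.det ≠ 0)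
    (X : Matrix (Fin k) (Fin n) K) : rowSpan (M * X) = rowSpan X := by
  refine le_antisymm (rowSpan_mul_le M X) ?_
  calc rowSpan X = rowSpan (M⁻¹ * (M * X)) := by
        rw [← Matrix.mul_assoc, Matrix.nonsing_inv_mul _ (isUnit_iff_ne_zero.2 hM), Matrix.one_mul]
    _ ≤ _ := rowSpan_mul_le _ _

theorem map_rowSpan (t : Fin n → Kˣ) (X : Matrix (Fin k) (Fin n) K) :
    (rowSpan X).map (torusScale t) = rowSpan (X * Matrix.diagonal fun i => (t i : K)) := by
  rw [rowSpan, Submodule.map_span, rowSpan, ← Set.range_comp]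
  congr 2
  funext a i
  simp [torusScale, mul_comm]

theorem minor_mul (M : Matrix (Fin k) (Fin k) K) (X : Matrix (Fin k) (Fin n) K)
    (f : Fin k → Fin n) : minor (M * X) f = M.det * minor X f := by
  rw [minor, minor, ← Matrix.det_mul]
  rfl

theorem minor_mul_diagonal (X : Matrix (Fin k) (Fin n) K) (d : Fin n → K) (f : Fin k → Fin n) :
    minor (X * Matrix.diagonal d) f = minor X f * ∏ a, d (f a) := by
  have : (X * Matrix.diagonal d).submatrix id f =
      X.submatrix id f * Matrix.diagonal (fun a => d (f a)) := by
    ext a b; simp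
  rw [minor, this, Matrix.det_mul, Matrix.det_diagonal, minor]

/-- The determinant is affine along a rank-one perturbation, so the two values add up to `2 *
A.det`. -/
theorem det_add_col_mul_row (h2 : (2 : K) ≠ 0) {A : Matrix (Fin k) (Fin k) K} (hA : A.det ≠ 0)
    (x y : Fin k → K) :
    (A + Matrix.vecMulVec x y).det ≠ 0 ∨ (A - Matrix.vecMulVec x y).det ≠ 0 := by
  have hu : IsUnit A.det := isUnit_iff_ne_zero.2 hA
  have e1 : ∀ x : Fin k → K, (A + Matrix.vecMulVec x y).det =
      A.det * (1 + (Matrix.replicateRow Unit y * A⁻¹ * Matrix.replicateCol Unit x) () ()) := by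
    intro x
    have h := Matrix.det_add_replicateCol_mul_replicateRow (ι := Unit) hu x y
    rw [← Matrix.vecMulVec_eq] at h
    rw [h, Matrix.det_unique (n := Unit)]
    rfl
  have e2 : A - Matrix.vecMulVec x y = A + Matrix.vecMulVec (-x) y := by
    rw [Matrix.neg_vecMulVec, sub_eq_add_neg]
  rw [e2, e1, e1]
  by_contra! h
  have e3 : (Matrix.replicateRow Unit y * A⁻¹ * Matrix.replicateCol Unit (-x)) () () =
      - (Matrix.replicateRow Unit y * A⁻¹ * Matrix.replicateCol Unit x) () () := by
    simp [Matrix.mul_apply]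
  rw [e3] at h
  obtain ⟨h1, h3⟩ := h
  have : A.det * 2 = 0 := by linear_combination h1 + h3
  exact (mul_ne_zero hA h2) this

/-- Some choice of signs makes two subspaces with a common nonzero Plücker coordinate pair
nondegenerately. -/
theorem exists_signs_det_ne_zero (h2 : (2 : K) ≠ 0) (X Y : Matrix (Fin k) (Fin n) K)
    (d : Fin n → K) (hd : ∀ i, d i ≠ 0) (I : Fin k ↪o Fin n) (hX : minor X I ≠ 0)
    (hY : minor Y I ≠ 0) :
    ∃ ε : Fin n → Kˣ, (∀ i, (ε i : K) = 1 ∨ (ε i : K) = -1) ∧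
      (X * Matrix.diagonal (fun i => d i * ε i) * Y.transpose).det ≠ 0 := by
  -- Starting from coefficients supported on `I`, the determinant is a product of two maximal minors
  -- and entries of `d`. The remaining coordinates are switched on one at a time; each is a rank-one
  -- perturbation, for which one of the two signs works.
  have key : ∀ S : Finset (Fin n), ∃ e : Fin n → K, (∀ i ∈ S, e i = 1 ∨ e i = -1) ∧
      (∀ i ∉ S, e i = if i ∈ Set.range I then 1 else 0) ∧
      (X * Matrix.diagonal (fun i => d i * e i) * Y.transpose).det ≠ 0 := by
    intro S
    induction S using Finset.induction_on with
    | empty =>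
      classical
      refine ⟨fun i => if i ∈ Set.range I then 1 else 0, by simp, fun _ _ => rfl, ?_⟩
      have : X * Matrix.diagonal (fun i => d i * (if i ∈ Set.range I then (1 : K) else 0)) *
          Y.transpose = (X * Matrix.diagonal d).submatrix id I * (Y.submatrix id I).transpose := by
        ext a b
        rw [mul_diagonal_mul_transpose_apply, Matrix.mul_apply]
        simp only [Matrix.mul_diagonal, Matrix.transpose_apply, Matrix.submatrix_apply, id,
          Set.mem_range]
        rw [← Finset.sum_subset (Finset.subset_univ (Finset.univ.map I.toEmbedding))]
        · rw [Finset.sum_map]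
          simp
        · intro i _ hi
          simp only [Finset.mem_map, Finset.mem_univ, true_and, not_exists] at hi
          rw [if_neg]
          · simp
          · rintro ⟨a, ha⟩
            exact hi a ha
      rw [this, Matrix.det_mul, Matrix.det_transpose]
      refine mul_ne_zero ?_ hY
      change minor _ _ ≠ 0
      rw [minor_mul_diagonal]
      exact mul_ne_zero hX (Finset.prod_ne_zero_iff.2 fun a _ => hd _)
    | insert i S hi ih =>
      obtain ⟨e, he1, he2, he⟩ := ih
      have hupd : ∀ c : K, X * Matrix.diagonal (fun j => d j * Function.update e i c j) *
          Y.transpose = X * Matrix.diagonal (fun j => d j * e j) * Y.transpose +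
            Matrix.vecMulVec (fun a => (c - e i) * (X a i * d i)) (fun b => Y b i) := by
        intro c
        ext a b
        simp only [mul_diagonal_mul_transpose_apply, Matrix.add_apply, Matrix.vecMulVec_apply]
        rw [← Finset.add_sum_erase _ _ (Finset.mem_univ i),
          ← Finset.add_sum_erase (a := i) (s := Finset.univ)
            (f := fun j => X a j * (d j * e j) * Y b j) (Finset.mem_univ i)]
        have : ∑ j ∈ Finset.univ.erase i, X a j * (d j * Function.update e i c j) * Y b j =
            ∑ j ∈ Finset.univ.erase i, X a j * (d j * e j) * Y b j := by
          refine Finset.sum_congr rfl fun j hj => ?_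
          rw [Function.update_of_ne (Finset.ne_of_mem_erase hj)]
        rw [this, Function.update_self]
        ring
      have hfin : ∀ c : K, (c = 1 ∨ c = -1) →
          (X * Matrix.diagonal (fun j => d j * Function.update e i c j) * Y.transpose).det ≠ 0 →
          ∃ e : Fin n → K, (∀ j ∈ insert i S, e j = 1 ∨ e j = -1) ∧
          (∀ j ∉ insert i S, e j = if j ∈ Set.range I then 1 else 0) ∧
          (X * Matrix.diagonal (fun j => d j * e j) * Y.transpose).det ≠ 0 := by
        intro c hc h
        refine ⟨Function.update e i c, fun j hj => ?_, fun j hj => ?_, h⟩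
        · by_cases hji : j = i
          · subst hji; simpa using hc
          · rw [Function.update_of_ne hji]
            exact he1 j ((Finset.mem_insert.1 hj).resolve_left hji)
        · rw [Finset.mem_insert, not_or] at hj
          rw [Function.update_of_ne hj.1]
          exact he2 j hj.2
      by_cases hiI : i ∈ Set.range I
      · refine hfin 1 (Or.inl rfl) ?_
        have : Function.update e i 1 = e := by
          rw [Function.update_eq_self_iff, he2 i hi, if_pos hiI]
        rwa [this]
      · have hei : e i = 0 := by rw [he2 i hi, if_neg hiI]
        rcases det_add_col_mul_row h2 he (fun a => X a i * d i) (fun b => Y b i) with h | h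
        · refine hfin 1 (Or.inl rfl) ?_
          rw [hupd]
          simpa [hei] using h
        · refine hfin (-1) (Or.inr rfl) ?_
          rw [hupd]
          have : (fun a => (-1 - e i) * (X a i * d i)) = - fun a => X a i * d i := by
            funext a; simp [hei]
          rwa [this, Matrix.neg_vecMulVec, ← sub_eq_add_neg]
  obtain ⟨e, he1, -, he⟩ := key Finset.univ
  have he0 : ∀ i, e i ≠ 0 := fun i => by
    rcases he1 i (Finset.mem_univ i) with h | h <;> simp [h]
  exact ⟨fun i => Units.mk0 (e i) (he0 i), fun i => he1 i (Finset.mem_univ i), by simpa using he⟩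

/-- Two isotropic subspaces with a common nonzero Plücker coordinate are joined, after a change of
signs of the second one, by a polynomial curve of isotropic subspaces. -/
theorem exists_isotropic_curve (h2 : (2 : K) ≠ 0) (u : Fin n → Kˣ)
    (X₀ X₁ : Matrix (Fin k) (Fin n) K) (h₀ : Isotropic (fun i => (u i : K)) (rowSpan X₀))
    (h₁ : Isotropic (fun i => (u i : K)) (rowSpan X₁)) (I : Fin k ↪o Fin n)
    (hX₀ : minor X₀ I ≠ 0) (hX₁ : minor X₁ I ≠ 0) :
    ∃ (Z : K → Matrix (Fin k) (Fin n) K) (ε : Fin n → Kˣ),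
      (∀ a i, (fun t => Z t a i) ∈ polyFun K) ∧
      (∀ t, Isotropic (fun i => (u i : K)) (rowSpan (Z t))) ∧
      (∀ i, (ε i : K) = 1 ∨ (ε i : K) = -1) ∧
      rowSpan (Z 0) = rowSpan X₀ ∧
      rowSpan (Z 1) = (rowSpan X₁).map (torusScale ε) := by
  classical
  -- A sign change of `X₀` gives an isotropic `Y` in perfect pairing with `X₀`, and a sign change of
  -- `X₁` then puts it too in perfect pairing with `Y`.
  obtain ⟨η, hη, hdet0⟩ := exists_signs_det_ne_zero h2 X₀ X₀ (fun i => (u i : K))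
    (fun i => (u i).ne_zero) I hX₀ hX₀
  obtain ⟨ε, hε, hdet1⟩ := exists_signs_det_ne_zero h2 X₁ X₀ (fun i => (u i : K) * η i)
    (fun i => mul_ne_zero (u i).ne_zero (η i).ne_zero) I hX₁ hX₀
  set D := Matrix.diagonal (fun i => (u i : K)) with hD
  set Y := X₀ * Matrix.diagonal (fun i => (η i : K)) with hY
  set X₁' := X₁ * Matrix.diagonal (fun i => (ε i : K)) with hX₁'
  have hsq : ∀ e : Fin n → Kˣ, (∀ i, (e i : K) = 1 ∨ (e i : K) = -1) →
      (fun i => (u i : K) * (e i : K) ^ 2) = fun i => (u i : K) := by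
    intro e he
    funext i
    rcases he i with h | h <;> simp [h]
  have hDT : D.transpose = D := Matrix.diagonal_transpose _
  have iY : Y * D * Y.transpose = 0 := by
    rw [← isotropic_rowSpan_iff_mul, hY, ← map_rowSpan, isotropic_map_torusScale, hsq η hη]
    exact h₀
  have i1 : X₁' * D * X₁'.transpose = 0 := by
    rw [← isotropic_rowSpan_iff_mul, hX₁', ← map_rowSpan, isotropic_map_torusScale, hsq ε hε]
    exact h₁
  have i0 : X₀ * D * X₀.transpose = 0 := isotropic_rowSpan_iff_mul.1 h₀
  set G₀ := X₀ * D * Y.transpose with hG₀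
  set G₁ := X₁' * D * Y.transpose with hG₁
  have hG₀d : G₀.det ≠ 0 := by
    convert hdet0 using 2
    rw [hG₀, hY, hD, Matrix.transpose_mul, Matrix.diagonal_transpose, ← Matrix.mul_assoc,
      Matrix.mul_assoc X₀, Matrix.diagonal_mul_diagonal]
  have hG₁d : G₁.det ≠ 0 := by
    convert hdet1 using 2
    rw [hG₁, hX₁', hY, hD, Matrix.transpose_mul, Matrix.diagonal_transpose, ← Matrix.mul_assoc,
      Matrix.mul_assoc X₁, Matrix.diagonal_mul_diagonal, Matrix.mul_assoc X₁,
      Matrix.diagonal_mul_diagonal]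
    congr 3
    funext i
    ring
  set A₀ := G₀⁻¹ * X₀ with hA₀
  set A₁ := G₁⁻¹ * X₁' with hA₁
  have u0 : IsUnit G₀.det := isUnit_iff_ne_zero.2 hG₀d
  have u1 : IsUnit G₁.det := isUnit_iff_ne_zero.2 hG₁d
  have d0 : G₀⁻¹.det ≠ 0 := (Matrix.isUnit_nonsing_inv_det _ u0).ne_zero
  have d1 : G₁⁻¹.det ≠ 0 := (Matrix.isUnit_nonsing_inv_det _ u1).ne_zero
  have b0 : A₀ * D * Y.transpose = 1 := by
    rw [hA₀, Matrix.mul_assoc, Matrix.mul_assoc, ← Matrix.mul_assoc X₀, ← hG₀,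
      Matrix.nonsing_inv_mul _ u0]
  have b1 : A₁ * D * Y.transpose = 1 := by
    rw [hA₁, Matrix.mul_assoc, Matrix.mul_assoc, ← Matrix.mul_assoc X₁', ← hG₁,
      Matrix.nonsing_inv_mul _ u1]
  have tr : ∀ P Q : Matrix (Fin k) (Fin n) K,
      (P * D * Q.transpose).transpose = Q * D * P.transpose := by
    intro P Q
    rw [Matrix.transpose_mul, Matrix.transpose_mul, hDT, Matrix.transpose_transpose,
      Matrix.mul_assoc]
  have b0' : Y * D * A₀.transpose = 1 := by rw [← tr, b0, Matrix.transpose_one]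
  have b1' : Y * D * A₁.transpose = 1 := by rw [← tr, b1, Matrix.transpose_one]
  have a0 : A₀ * D * A₀.transpose = 0 := by
    rw [← isotropic_rowSpan_iff_mul, hA₀, rowSpan_mul d0]
    exact h₀
  have a1 : A₁ * D * A₁.transpose = 0 := by
    rw [← isotropic_rowSpan_iff_mul, hA₁, rowSpan_mul d1, isotropic_rowSpan_iff_mul]
    exact i1
  set N := A₀ * D * A₁.transpose with hN
  have hNt : A₁ * D * A₀.transpose = N.transpose := by rw [hN, tr]
  -- The affine combination of `A₀` and `A₁` has Gram matrix `t (1 - t) (N + Nᵀ)` and pairs with `Y`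
  -- to the identity. As `Y` is isotropic, subtracting `t (1 - t) N Y` cancels this Gram matrix and
  -- adds no quadratic term.
  refine ⟨fun t => (1 - t) • A₀ + t • A₁ - (t * (1 - t)) • (N * Y), ε, ?_, ?_, hε, ?_, ?_⟩
  · intro a i
    have ht := id_mem_polyFun (K := K)
    have h1t : (fun t : K => 1 - t) ∈ polyFun K := sub_mem (const_mem_polyFun 1) ht
    exact sub_mem (add_mem (mul_mem h1t (const_mem_polyFun (A₀ a i)))
      (mul_mem ht (const_mem_polyFun (A₁ a i))))
      (mul_mem (mul_mem ht h1t) (const_mem_polyFun ((N * Y) a i)))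
  · intro t
    rw [isotropic_rowSpan_iff_mul, ← hD]
    have e : ∀ P : Matrix (Fin k) (Fin n) K, P * D * (N * Y).transpose =
        P * D * Y.transpose * N.transpose := by
      intro P
      rw [Matrix.transpose_mul, Matrix.mul_assoc (P * D)]
    have e' : ∀ P : Matrix (Fin n) (Fin k) K, N * Y * D * P = N * (Y * D * P) := by
      intro P
      simp only [Matrix.mul_assoc]
    simp only [Matrix.transpose_sub, Matrix.transpose_add, Matrix.transpose_smul, Matrix.sub_mul,
      Matrix.add_mul, Matrix.mul_sub, Matrix.mul_add, Matrix.smul_mul, Matrix.mul_smul, e, a0, a1,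
      b0, b1, hNt, ← hN, e', b0', b1', iY]
    simp only [Matrix.one_mul, Matrix.mul_one, Matrix.mul_zero, Matrix.zero_mul]
    module
  · simp [hA₀, rowSpan_mul d0]
  · simp [hA₁, rowSpan_mul d1, hX₁', map_rowSpan]

end Isotropic


section Pluecker

variable {K : Type*} [Field K] {k n : ℕ}

/-! ### Matrices and points of the Grassmannian -/

/-- The chosen matrix with row span `V`. -/
def stdMatrix (V : Gr K k n) : Matrix (Fin k) (Fin n) K :=
  rowMatrix (Module.finBasisOfFinrankEq K V.1 V.2)

theorem plucker_eq_minor (V : Gr K k n) (I : Fin k ↪o Fin n) :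
    plucker V I = minor (stdMatrix V) I := rfl

theorem rowSpan_rowMatrix {V : Submodule K (Fin n → K)} (b : Module.Basis (Fin k) K V) :
    rowSpan (rowMatrix b) = V := by
  have h := congrArg (Submodule.map V.subtype) b.span_eq
  rw [Submodule.map_span, Submodule.map_top, Submodule.range_subtype, ← Set.range_comp] at h
  exact h

theorem rowSpan_stdMatrix (V : Gr K k n) : rowSpan (stdMatrix V) = V.1 := rowSpan_rowMatrix _

theorem exists_rowMatrix_eq_mul {V : Submodule K (Fin n → K)} (b b' : Module.Basis (Fin k) K V) :
    ∃ M : Matrix (Fin k) (Fin k) K, M.det ≠ 0 ∧ rowMatrix b = M * rowMatrix b' := by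
  refine ⟨(b'.toMatrix b).transpose, ?_, ?_⟩
  · rw [Matrix.det_transpose, ← Module.Basis.det_apply]
    exact (b'.isUnit_det b).ne_zero
  · ext a j
    have h := congrArg (fun v : V => (v : Fin n → K) j) (b'.sum_toMatrix_smul_self b a)
    simp only [Submodule.coe_sum, Submodule.coe_smul, Finset.sum_apply, Pi.smul_apply,
      smul_eq_mul] at h
    simp only [rowMatrix, Matrix.of_apply, Matrix.mul_apply, Matrix.transpose_apply]
    exact h.symm

theorem linearIndependent_row_of_minor_ne_zero {X : Matrix (Fin k) (Fin n) K} {f : Fin k → Fin n}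
    (h : minor X f ≠ 0) : LinearIndependent K X.row := by
  have h1 : LinearIndependent K (X.submatrix id f).row :=
    Matrix.linearIndependent_rows_of_det_ne_zero h
  exact LinearIndependent.of_comp (LinearMap.funLeft K K f) h1

theorem exists_gr {X : Matrix (Fin k) (Fin n) K} {f : Fin k → Fin n} (h : minor X f ≠ 0) :
    ∃ V : Gr K k n, V.1 = rowSpan X :=
  ⟨⟨rowSpan X, by
    rw [rowSpan, finrank_span_eq_card (linearIndependent_row_of_minor_ne_zero h),
      Fintype.card_fin]⟩, rfl⟩

theorem exists_eq_mul_stdMatrix {X : Matrix (Fin k) (Fin n) K} (V : Gr K k n)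
    (hV : V.1 = rowSpan X) :
    ∃ M : Matrix (Fin k) (Fin k) K, M.det ≠ 0 ∧ X = M * stdMatrix V := by
  obtain ⟨V, hk⟩ := V
  dsimp only at hV
  subst hV
  have hli : LinearIndependent K X.row :=
    linearIndependent_iff_card_eq_finrank_span.2 (by rw [Fintype.card_fin]; exact hk.symm)
  obtain ⟨M, hM, h⟩ := exists_rowMatrix_eq_mul (Module.Basis.span hli)
    (Module.finBasisOfFinrankEq K (rowSpan X) hk)
  refine ⟨M, hM, ?_⟩
  refine Eq.trans ?_ h
  ext a i
  simp [rowMatrix, Module.Basis.span_apply]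

theorem exists_minor_eq {X : Matrix (Fin k) (Fin n) K} (V : Gr K k n) (hV : V.1 = rowSpan X) :
    ∃ c : K, c ≠ 0 ∧ ∀ f : Fin k → Fin n, minor X f = c * minor (stdMatrix V) f := by
  obtain ⟨M, hM, h⟩ := exists_eq_mul_stdMatrix V hV
  refine ⟨M.det, hM, fun f => ?_⟩
  rw [← minor_mul, ← h]

theorem exists_perm_comp_orderEmbedding {f : Fin k → Fin n} (hf : Function.Injective f) :
    ∃ (σ : Equiv.Perm (Fin k)) (I : Fin k ↪o Fin n), f ∘ σ = I :=
  ⟨Tuple.sort f, OrderEmbedding.ofStrictMono (f ∘ Tuple.sort f)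
    ((Tuple.monotone_sort f).strictMono_of_injective (hf.comp (Tuple.sort f).injective)), rfl⟩

theorem minor_comp_perm (X : Matrix (Fin k) (Fin n) K) (f : Fin k → Fin n)
    (σ : Equiv.Perm (Fin k)) :
    minor X (f ∘ σ) = (Equiv.Perm.sign σ : ℤ) * minor X f := by
  rw [minor, minor, ← Matrix.det_permute']
  rfl

theorem minor_eq_zero_of_not_injective (X : Matrix (Fin k) (Fin n) K) {f : Fin k → Fin n}
    (hf : ¬ Function.Injective f) : minor X f = 0 := by
  simp only [Function.Injective, not_forall] at hf
  obtain ⟨a, b, hab, hne⟩ := hf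
  exact Matrix.det_zero_of_column_eq hne fun i => by simp [hab]

theorem minor_ne_zero_of_injective {X : Matrix (Fin k) (Fin n) K}
    (h : ∀ I : Fin k ↪o Fin n, minor X I ≠ 0) {f : Fin k → Fin n} (hf : Function.Injective f) :
    minor X f ≠ 0 := by
  obtain ⟨σ, I, hI⟩ := exists_perm_comp_orderEmbedding hf
  have := h I
  rw [← hI, minor_comp_perm] at this
  exact right_ne_zero_of_mul this

theorem exists_minor_ne_zero_of_span_col (X : Matrix (Fin k) (Fin n) K)
    (h : Submodule.span K (Set.range X.col) = ⊤) : ∃ I : Fin k ↪o Fin n, minor X I ≠ 0 := by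
  obtain ⟨f, hf, -, hli⟩ := Submodule.exists_fun_fin_finrank_span_eq K (Set.range X.col)
  have hk : Module.finrank K (Submodule.span K (Set.range X.col)) = k := by
    rw [h, finrank_top, Module.finrank_fin_fun]
  choose g hg using hf
  obtain ⟨g', hg'⟩ : ∃ g' : Fin k → Fin n, LinearIndependent K fun a => X.col (g' a) := by
    refine ⟨fun a => g (Fin.cast hk.symm a), ?_⟩
    simp only [hg]
    exact hli.comp _ (Fin.cast_injective _)
  have hdet : minor X g' ≠ 0 := by
    have : IsUnit (X.submatrix id g') := Matrix.linearIndependent_cols_iff_isUnit.1 hg'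
    exact ((Matrix.isUnit_iff_isUnit_det _).1 this).ne_zero
  have hinj : Function.Injective g' := by
    by_contra hc
    exact hdet (minor_eq_zero_of_not_injective X hc)
  obtain ⟨σ, I, hI⟩ := exists_perm_comp_orderEmbedding hinj
  refine ⟨I, ?_⟩
  rw [← hI, minor_comp_perm]
  refine mul_ne_zero ?_ hdet
  rcases Int.units_eq_one_or (Equiv.Perm.sign σ) with h | h <;> simp [h]

theorem plucker_ne_zero_iff {X : Matrix (Fin k) (Fin n) K} (V : Gr K k n) (hV : V.1 = rowSpan X)
    (I : Fin k ↪o Fin n) : plucker V I ≠ 0 ↔ minor X I ≠ 0 := by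
  obtain ⟨c, hc, h⟩ := exists_minor_eq V hV
  rw [h, plucker_eq_minor, mul_ne_zero_iff]
  exact ⟨fun h => ⟨hc, h⟩, fun h => h.2⟩

theorem exists_grOpen (hkn : k ≤ n) (X : Matrix (Fin k) (Fin n) K)
    (h : ∀ I : Fin k ↪o Fin n, minor X I ≠ 0) : ∃ V : GrOpen K k n, V.1.1 = rowSpan X := by
  obtain ⟨V, hV⟩ := exists_gr (h (Fin.castLEOrderEmb hkn))
  exact ⟨⟨V, fun I => (plucker_ne_zero_iff V hV I).2 (h I)⟩, hV⟩

theorem exists_torusScale (hkn : k ≤ n) (V : GrOpen K k n) (t : Fin n → Kˣ) :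
    ∃ W : GrOpen K k n, W.1.1 = V.1.1.map (torusScale t) := by
  rw [← rowSpan_stdMatrix, map_rowSpan]
  refine exists_grOpen hkn _ fun I => ?_
  rw [minor_mul_diagonal]
  exact mul_ne_zero (V.2 I) (Finset.prod_ne_zero_iff.2 fun a _ => (t _).ne_zero)

theorem mem_OGr_iff {l : Fin n → Kˣ} {V : Gr K k n} :
    V ∈ OGr l ↔ Isotropic (fun i => (l i : K)) V.1 := Iff.rfl

theorem toX_eq_iff {V W : GrOpen K k n} :
    toX V = toX W ↔ ∃ t : Fin n → Kˣ, W.1.1 = V.1.1.map (torusScale t) :=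
  Quotient.eq (r := torusSetoid K k n)

theorem grOpen_ext {V W : GrOpen K k n} (h : V.1.1 = W.1.1) : V = W :=
  Subtype.ext (Subtype.ext h)

/-! ### Regular functions and homogeneous polynomials -/

theorem plucker_div_mem (I J : Fin k ↪o Fin n) :
    (fun V : GrOpen K k n => plucker V.1 I / plucker V.1 J) ∈ grRing K k n :=
  Algebra.subset_adjoin ⟨(I, J), rfl⟩

theorem minor_div_minor_mem (f g : Fin k → Fin n) :
    (fun V : GrOpen K k n => minor (stdMatrix V.1) f / minor (stdMatrix V.1) g) ∈ grRing K k n := by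
  by_cases hf : Function.Injective f
  · by_cases hg : Function.Injective g
    · obtain ⟨σ, I, hI⟩ := exists_perm_comp_orderEmbedding hf
      obtain ⟨τ, J, hJ⟩ := exists_perm_comp_orderEmbedding hg
      have h : f = I ∘ σ.symm := by rw [← hI]; funext a; simp
      have h' : g = J ∘ τ.symm := by rw [← hJ]; funext a; simp
      have := (grRing K k n).zsmul_mem (plucker_div_mem I J)
        (Equiv.Perm.sign σ.symm * Equiv.Perm.sign τ.symm : ℤ)
      convert this using 1
      funext V
      rw [h, h', minor_comp_perm, minor_comp_perm, Pi.smul_apply, zsmul_eq_mul, plucker_eq_minor,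
        plucker_eq_minor]
      rcases Int.units_eq_one_or (Equiv.Perm.sign τ.symm) with h | h <;>
        simp [h, mul_div_assoc, div_neg]
    · simp only [minor_eq_zero_of_not_injective _ hg, div_zero]
      exact zero_mem _
  · simp only [minor_eq_zero_of_not_injective _ hf, zero_div]
    exact zero_mem _

theorem eval_mul_of_isHomogeneous {σ : Type*} {F : MvPolynomial σ K} {d : ℕ}
    (hF : F.IsHomogeneous d) (c : K) (x : σ → K) :
    MvPolynomial.eval (fun i => c * x i) F = c ^ d * MvPolynomial.eval x F := by
  rw [MvPolynomial.eval_eq, MvPolynomial.eval_eq, Finset.mul_sum]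
  refine Finset.sum_congr rfl fun m hm => ?_
  have := hF.degree_eq_sum_deg_support hm
  simp only [mul_pow, Finset.prod_mul_distrib, Finset.prod_pow_eq_pow_sum, ← this]
  ring

/-- A power of the product of all Plücker coordinates clears the denominators. Ratios have degree
zero, so the degree is that of the power; this links regular functions to the homogeneous equations
defining the closure. -/
theorem exists_isHomogeneous_of_mem {a : GrOpen K k n → K} (ha : a ∈ grRing K k n) :
    ∃ (N : ℕ) (F : MvPolynomial (Fin k ↪o Fin n) K),
      F.IsHomogeneous (Fintype.card (Fin k ↪o Fin n) * N) ∧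
      ∀ V : GrOpen K k n, MvPolynomial.eval (plucker V.1) F = a V * (∏ I, plucker V.1 I) ^ N := by
  have hP : (∏ I : Fin k ↪o Fin n, MvPolynomial.X I : MvPolynomial _ K).IsHomogeneous
      (Fintype.card (Fin k ↪o Fin n)) := by
    have := MvPolynomial.IsHomogeneous.prod (R := K) Finset.univ
      (fun I : Fin k ↪o Fin n => MvPolynomial.X I) (fun _ => 1)
      fun I _ => MvPolynomial.isHomogeneous_X K I
    simpa using this
  induction ha using Algebra.adjoin_induction with
  | mem x hx =>
    obtain ⟨⟨I, J⟩, rfl⟩ := hx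
    classical
    refine ⟨1, MvPolynomial.X I * ∏ L ∈ Finset.univ.erase J, MvPolynomial.X L, ?_, fun V => ?_⟩
    · have := (MvPolynomial.isHomogeneous_X K I).mul
        (MvPolynomial.IsHomogeneous.prod (R := K) (Finset.univ.erase J)
        (fun I : Fin k ↪o Fin n => MvPolynomial.X I) (fun _ => 1)
        fun I _ => MvPolynomial.isHomogeneous_X K I)
      convert this using 1
      have hpos : 0 < Fintype.card (Fin k ↪o Fin n) := Fintype.card_pos_iff.2 ⟨J⟩
      simp only [mul_one, Finset.sum_const, smul_eq_mul, Finset.card_erase_of_mem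
        (Finset.mem_univ J), Finset.card_univ]
      omega
    · rw [map_mul, MvPolynomial.eval_X, map_prod, pow_one,
        ← Finset.mul_prod_erase _ _ (Finset.mem_univ J)]
      simp only [MvPolynomial.eval_X]
      have := V.2 J
      field_simp
  | algebraMap r =>
    exact ⟨0, MvPolynomial.C r, by simpa using MvPolynomial.isHomogeneous_C _ r, fun V => by simp⟩
  | add x y _ _ hx hy =>
    obtain ⟨N, F, hF, h⟩ := hx
    obtain ⟨N', F', hF', h'⟩ := hy
    refine ⟨N + N', F * (∏ I, MvPolynomial.X I) ^ N' + F' * (∏ I, MvPolynomial.X I) ^ N, ?_,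
      fun V => ?_⟩
    · rw [mul_add]
      refine (hF.mul (hP.pow N')).add ?_
      rw [add_comm]
      exact hF'.mul (hP.pow N)
    · simp only [map_add, map_mul, map_pow, map_prod, MvPolynomial.eval_X, h, h', Pi.add_apply]
      ring
  | mul x y _ _ hx hy =>
    obtain ⟨N, F, hF, h⟩ := hx
    obtain ⟨N', F', hF', h'⟩ := hy
    refine ⟨N + N', F * F', ?_, fun V => ?_⟩
    · rw [mul_add]
      exact hF.mul hF'
    · simp only [map_mul, h, h', Pi.mul_apply]
      ring

/-- Points on a curve are given by matrices with polynomial entries. By homogeneity nonvanishing of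
`F` does not depend on the basis, so nonvanishing of `a` along the curve becomes a polynomial
condition in the parameter. -/
theorem exists_eval_minor_ne_zero_iff {a : GrOpen K k n → K} (ha : a ∈ grRing K k n) :
    ∃ F : MvPolynomial (Fin k ↪o Fin n) K, ∀ (X : Matrix (Fin k) (Fin n) K) (V : GrOpen K k n),
      V.1.1 = rowSpan X → (MvPolynomial.eval (fun I : Fin k ↪o Fin n => minor X I) F ≠ 0 ↔ a V ≠ 0) := by
  obtain ⟨N, F, hF, h⟩ := exists_isHomogeneous_of_mem ha
  refine ⟨F, fun X V hV => ?_⟩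
  obtain ⟨c, hc, hcX⟩ := exists_minor_eq V.1 hV
  simp only [hcX]
  rw [eval_mul_of_isHomogeneous hF]
  change _ * MvPolynomial.eval (plucker V.1) F ≠ 0 ↔ _
  rw [h]
  simp [hc, Finset.prod_eq_zero_iff, V.2]

/-- A regular function on `Gr(k,n)°` vanishing on a subset vanishes on its Zariski closure. -/
theorem eq_zero_of_mem_zariskiClosure {a : GrOpen K k n → K} (ha : a ∈ grRing K k n)
    {S : Set (Gr K k n)} (h : ∀ V : GrOpen K k n, V.1 ∈ S → a V = 0) (V : GrOpen K k n)
    (hV : V.1 ∈ zariskiClosure S) : a V = 0 := by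
  obtain ⟨N, F, hF, hFa⟩ := exists_isHomogeneous_of_mem ha
  have hP : (∏ I : Fin k ↪o Fin n, MvPolynomial.X I : MvPolynomial _ K).IsHomogeneous
      (Fintype.card (Fin k ↪o Fin n)) := by
    have := MvPolynomial.IsHomogeneous.prod (R := K) Finset.univ
      (fun I : Fin k ↪o Fin n => MvPolynomial.X I) (fun _ => 1)
      fun I _ => MvPolynomial.isHomogeneous_X K I
    simpa using this
  -- The extra factor forces vanishing at the points of `S` with some zero Plücker coordinate, about
  -- which `a` says nothing.
  have := hV _ (F * ∏ I, MvPolynomial.X I) (hF.mul hP) fun W hW => by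
    rw [map_mul, map_prod]
    simp only [MvPolynomial.eval_X]
    by_cases hW0 : ∀ I, plucker W I ≠ 0
    · rw [hFa ⟨W, hW0⟩, h ⟨W, hW0⟩ hW]
      simp
    · push Not at hW0
      obtain ⟨I, hI⟩ := hW0
      rw [Finset.prod_eq_zero (Finset.mem_univ I) hI, mul_zero]
  rw [map_mul, hFa, map_prod] at this
  simp only [MvPolynomial.eval_X] at this
  simpa [Finset.prod_eq_zero_iff, V.2] using this

theorem exists_xRing_lift {f : GrOpen K k n → K} (hf : f ∈ grRing K k n)
    (h : ∀ V W, toX V = toX W → f V = f W) :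
    ∃ F ∈ xRing K k n, ∀ V, F (toX V) = f V := by
  refine ⟨Quotient.lift (s := torusSetoid K k n) f fun V W hVW => h V W (Quotient.sound hVW),
    ?_, fun V => rfl⟩
  exact hf

/-- If the product of two regular functions vanishes on an orthogonal Grassmannian, and the second
one is torus-invariant and does not vanish identically, then the first one vanishes. -/
theorem eq_zero_of_mul_eq_zero_of_isotropic [Infinite K] (h2 : (2 : K) ≠ 0) (hkn : k ≤ n)
    (u : Fin n → Kˣ) {a h : GrOpen K k n → K} (ha : a ∈ grRing K k n) (hh : h ∈ grRing K k n)
    (hinv : ∀ V W, toX V = toX W → h V = h W)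
    (hah : ∀ V : GrOpen K k n, V.1 ∈ OGr u → a V * h V = 0)
    {V₁ : GrOpen K k n} (hV₁ : V₁.1 ∈ OGr u) (h₁ : h V₁ ≠ 0)
    (V : GrOpen K k n) (hV : V.1 ∈ OGr u) : a V = 0 := by
  by_contra haV
  rw [mem_OGr_iff, ← rowSpan_stdMatrix] at hV hV₁
  obtain ⟨Z, ε, hZ, hiso, hε, hZ0, hZ1⟩ := exists_isotropic_curve h2 u _ _ hV hV₁
    (Fin.castLEOrderEmb hkn) (V.2 _) (V₁.2 _)
  rw [rowSpan_stdMatrix] at hZ0 hZ1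
  obtain ⟨W, hW⟩ := exists_torusScale hkn V₁ ε
  obtain ⟨F, hF⟩ := exists_eval_minor_ne_zero_iff ha
  obtain ⟨G, hG⟩ := exists_eval_minor_ne_zero_iff hh
  have hmin : ∀ f : Fin k → Fin n, (fun t => minor (Z t) f) ∈ polyFun K := fun f =>
    det_mem _ _ fun i j => hZ i (f j)
  have hFp := mvPolynomial_eval_mem (polyFun K) F (fun t I => minor (Z t) I) fun I => hmin I
  have hGp := mvPolynomial_eval_mem (polyFun K) G (fun t I => minor (Z t) I) fun I => hmin I
  have hPp : (fun t => ∏ I : Fin k ↪o Fin n, minor (Z t) I) ∈ polyFun K := by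
    have := (polyFun K).prod_mem (t := Finset.univ)
      (f := fun (I : Fin k ↪o Fin n) t => minor (Z t) I) fun I _ => hmin I
    convert this using 1
    funext t
    simp
  have e0 := (hF (Z 0) V hZ0.symm).2 haV
  -- The curve ends at `V₁` only up to signs; torus invariance carries `h V₁ ≠ 0` over to the
  -- endpoint.
  have e1 := (hG (Z 1) W (hW.trans hZ1.symm)).2
    (by rwa [← hinv V₁ W (toX_eq_iff.2 ⟨ε, hW⟩)])
  have e2 : ∏ I : Fin k ↪o Fin n, minor (Z 0) I ≠ 0 :=
    Finset.prod_ne_zero_iff.2 fun I _ => (plucker_ne_zero_iff V.1 hZ0.symm I).1 (V.2 I)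
  obtain ⟨hp, t, ht⟩ := mul_ne_zero_of_mem_polyFun hFp hGp e0 e1
  obtain ⟨-, t, ht⟩ := mul_ne_zero_of_mem_polyFun hp hPp ht e2
  have ht1 := right_ne_zero_of_mul ht
  have ht2 := right_ne_zero_of_mul (left_ne_zero_of_mul ht)
  have ht3 := left_ne_zero_of_mul (left_ne_zero_of_mul ht)
  obtain ⟨U, hU⟩ := exists_grOpen hkn (Z t) fun I =>
    Finset.prod_ne_zero_iff.1 ht1 I (Finset.mem_univ I)
  have := hah U (by rw [mem_OGr_iff, hU]; exact hiso t)
  exact mul_ne_zero ((hF _ U hU).1 ht3) ((hG _ U hU).1 ht2) this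

end Pluecker


section Normalization

variable {K : Type*} [Field K] {k n : ℕ}

/-! ### Torus-invariant coordinates -/

/-- A regular section of the quotient of `Gr(k,n)°` by the torus: every point is obtained, by
rescaling the coordinates by `scale`, from the row space of a matrix depending only on its orbit. -/
structure Normalization (K : Type*) [Field K] (k n : ℕ) where
  /-- the matrix representing an orbit -/
  mat : GrOpen K k n → Matrix (Fin k) (Fin n) K
  /-- the scaling factors -/
  scale : GrOpen K k n → Fin n → Kˣ
  /-- the coordinate with scaling factor one -/
  base : Fin n
  mat_mem : ∀ a i, (fun V => mat V a i) ∈ grRing K k n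
  scale_mem : ∀ i, (fun V => (scale V i : K)) ∈ grRing K k n
  scale_inv_mem : ∀ i, (fun V => (scale V i : K)⁻¹) ∈ grRing K k n
  eq_map : ∀ V : GrOpen K k n, V.1.1 = (rowSpan (mat V)).map (torusScale (scale V))
  mat_eq : ∀ V W, toX V = toX W → mat V = mat W
  scale_base : ∀ V, scale V base = 1
  scale_map : ∀ (V W : GrOpen K k n) (t : Fin n → Kˣ), W.1.1 = V.1.1.map (torusScale t) →
    ∀ i, scale W i = t i * scale V i / t base

/-- The matrix with row space `V` whose columns `I` form the identity matrix. -/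
def chart (I : Fin k ↪o Fin n) (V : GrOpen K k n) : Matrix (Fin k) (Fin n) K :=
  Matrix.of fun a i => minor (stdMatrix V.1) (Function.update I a i) / minor (stdMatrix V.1) I

theorem chart_apply_of_eq_rowSpan (I : Fin k ↪o Fin n) (V : GrOpen K k n)
    {X : Matrix (Fin k) (Fin n) K} (hX : V.1.1 = rowSpan X) (a : Fin k) (i : Fin n) :
    chart I V a i = minor X (Function.update I a i) / minor X I := by
  obtain ⟨c, hc, h⟩ := exists_minor_eq V.1 hX
  rw [h, h, mul_div_mul_left _ _ hc]
  rfl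

/-- This is Cramer's rule for the system with the columns `I`. -/
theorem chart_eq_mul (I : Fin k ↪o Fin n) (V : GrOpen K k n) :
    chart I V = ((stdMatrix V.1).submatrix id I)⁻¹ * stdMatrix V.1 := by
  ext a i
  have h : minor (stdMatrix V.1) (Function.update I a i) =
      (((stdMatrix V.1).submatrix id I).adjugate * stdMatrix V.1) a i := by
    have := congrFun (Matrix.cramer_eq_adjugate_mulVec ((stdMatrix V.1).submatrix id I)
      ((stdMatrix V.1).col i)) a
    rw [Matrix.cramer_apply] at this
    refine Eq.trans ?_ this
    rw [minor]
    congr 1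
    ext b c
    by_cases hc : c = a
    · subst hc; simp
    · simp [Matrix.updateCol_ne hc, Function.update_of_ne hc]
  rw [Matrix.inv_def, Matrix.smul_mul, Matrix.smul_apply, ← h, chart, Matrix.of_apply,
    Ring.inverse_eq_inv', smul_eq_mul, div_eq_inv_mul]
  rfl

theorem rowSpan_chart (I : Fin k ↪o Fin n) (V : GrOpen K k n) : rowSpan (chart I V) = V.1.1 := by
  have h : IsUnit ((stdMatrix V.1).submatrix id I).det := isUnit_iff_ne_zero.2 (V.2 I)
  rw [chart_eq_mul, rowSpan_mul (Matrix.isUnit_nonsing_inv_det _ h).ne_zero, rowSpan_stdMatrix]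

theorem chart_torusScale (I : Fin k ↪o Fin n) {V W : GrOpen K k n} {t : Fin n → Kˣ}
    (h : W.1.1 = V.1.1.map (torusScale t)) (a : Fin k) (i : Fin n) :
    chart I W a i = (t i : K) / t (I a) * chart I V a i := by
  rw [← rowSpan_stdMatrix V.1, map_rowSpan] at h
  rw [chart_apply_of_eq_rowSpan I W h, minor_mul_diagonal, minor_mul_diagonal, chart,
    Matrix.of_apply, ← Finset.mul_prod_erase _ _ (Finset.mem_univ a),
    ← Finset.mul_prod_erase _ (fun b => ((t (I b) : Kˣ) : K)) (Finset.mem_univ a)]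
  have : ∏ b ∈ Finset.univ.erase a, (t (Function.update I a i b) : K) =
      ∏ b ∈ Finset.univ.erase a, (t (I b) : K) :=
    Finset.prod_congr rfl fun b hb => by rw [Function.update_of_ne (Finset.ne_of_mem_erase hb)]
  rw [this, Function.update_self]
  have h1 : ∏ b ∈ Finset.univ.erase a, (t (I b) : K) ≠ 0 :=
    Finset.prod_ne_zero_iff.2 fun _ _ => Units.ne_zero _
  have h2 : (t (I a) : K) ≠ 0 := Units.ne_zero _
  have h3 : minor (stdMatrix V.1) I ≠ 0 := V.2 I
  field_simp

theorem update_injective {I : Fin k ↪o Fin n} {i : Fin n} (hi : i ∉ Set.range I) (a : Fin k) :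
    Function.Injective (Function.update I a i) := by
  intro b c hbc
  by_cases hb : b = a <;> by_cases hc : c = a
  · rw [hb, hc]
  · subst hb
    rw [Function.update_self, Function.update_of_ne hc] at hbc
    exact absurd ⟨c, hbc.symm⟩ hi
  · subst hc
    rw [Function.update_self, Function.update_of_ne hb] at hbc
    exact absurd ⟨b, hbc⟩ hi
  · rw [Function.update_of_ne hb, Function.update_of_ne hc] at hbc
    exact I.injective hbc

theorem chart_ne_zero {I : Fin k ↪o Fin n} {i : Fin n} (hi : i ∉ Set.range I) (V : GrOpen K k n)
    (a : Fin k) : chart I V a i ≠ 0 := by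
  rw [chart, Matrix.of_apply]
  exact div_ne_zero (minor_ne_zero_of_injective V.2 (update_injective hi a)) (V.2 I)

theorem chart_mem (I : Fin k ↪o Fin n) (a : Fin k) (i : Fin n) :
    (fun V : GrOpen K k n => chart I V a i) ∈ grRing K k n := minor_div_minor_mem _ _

theorem inv_chart_mem (I : Fin k ↪o Fin n) (a : Fin k) (i : Fin n) :
    (fun V : GrOpen K k n => (chart I V a i)⁻¹) ∈ grRing K k n := by
  simp only [chart, Matrix.of_apply, inv_div]
  exact minor_div_minor_mem _ _

/-- The normal form has the identity in the first `k` columns, and ones in the column `j₀` and,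
outside the identity block, in the row `a₀`. Chart entries outside the identity block are ratios of
nonzero minors, hence invertible, so scaling rows and columns reaches this form by regular factors.
-/
theorem nonempty_normalization (hk : 1 ≤ k) (hkn : k < n) : Nonempty (Normalization K k n) := by
  classical
  set I : Fin k ↪o Fin n := Fin.castLEOrderEmb hkn.le with hI
  set j₀ : Fin n := ⟨k, hkn⟩ with hj₀
  set a₀ : Fin k := ⟨0, hk⟩ with ha₀
  have hrange : ∀ i : Fin n, i ∈ Set.range I ↔ i.1 < k := by
    intro i
    constructor
    · rintro ⟨a, rfl⟩
      exact a.2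
    · intro h
      exact ⟨⟨i.1, h⟩, rfl⟩
  have hj : j₀ ∉ Set.range I := by rw [hrange]; exact lt_irrefl k
  have hβ := fun V a => chart_ne_zero (K := K) hj V a
  set s : GrOpen K k n → Fin n → K := fun V i =>
    if h : i.1 < k then (chart I V ⟨i, h⟩ j₀)⁻¹ else chart I V a₀ i / chart I V a₀ j₀ with hs
  have hs0 : ∀ V i, s V i ≠ 0 := by
    intro V i
    simp only [hs]
    split_ifs with h
    · exact inv_ne_zero (hβ _ _)
    · exact div_ne_zero (chart_ne_zero (by rwa [hrange]) _ _) (hβ _ _)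
  have hsmem : ∀ i, (fun V => s V i) ∈ grRing K k n := by
    intro i
    simp only [hs]
    split_ifs with h
    · exact inv_chart_mem _ _ _
    · simp only [div_eq_mul_inv]
      exact mul_mem (chart_mem I a₀ i) (inv_chart_mem I a₀ j₀)
  have hsinv : ∀ i, (fun V => (s V i)⁻¹) ∈ grRing K k n := by
    intro i
    simp only [hs]
    split_ifs with h
    · simp only [inv_inv]
      exact chart_mem _ _ _
    · simp only [inv_div]
      simp only [div_eq_mul_inv]
      exact mul_mem (chart_mem I a₀ j₀) (inv_chart_mem I a₀ i)
  have hsmap : ∀ (V W : GrOpen K k n) (t : Fin n → Kˣ), W.1.1 = V.1.1.map (torusScale t) →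
      ∀ i, s W i = t i * s V i / t j₀ := by
    intro V W t h i
    have h1 : ∀ i, (t i : K) ≠ 0 := fun i => Units.ne_zero _
    simp only [hs]
    split_ifs with hi
    · have e : I ⟨i, hi⟩ = i := rfl
      rw [chart_torusScale I h, e]
      have := h1 i
      have := h1 j₀
      have := hβ V ⟨i, hi⟩
      field_simp
    · rw [chart_torusScale I h, chart_torusScale I h]
      have := h1 j₀
      have := h1 (I a₀)
      have := hβ V a₀
      field_simp
  set N : GrOpen K k n → Matrix (Fin k) (Fin n) K := fun V =>
    Matrix.diagonal (fun a => (chart I V a j₀)⁻¹) * chart I V *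
      Matrix.diagonal (fun i => (s V i)⁻¹) with hN
  have hNa : ∀ V a i, N V a i = (chart I V a j₀)⁻¹ * chart I V a i * (s V i)⁻¹ := by
    intro V a i
    simp only [hN, Matrix.mul_diagonal, Matrix.diagonal_mul]
  refine ⟨⟨N, fun V i => Units.mk0 (s V i) (hs0 V i), j₀, ?_, hsmem, hsinv, ?_, ?_, ?_, ?_⟩⟩
  · intro a i
    simp only [hNa]
    exact mul_mem (mul_mem (inv_chart_mem _ _ _) (chart_mem _ _ _)) (hsinv i)
  · intro V
    rw [map_rowSpan, hN, Matrix.mul_assoc, Matrix.diagonal_mul_diagonal]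
    simp only [Units.val_mk0, inv_mul_cancel₀ (hs0 V _), Matrix.diagonal_one, Matrix.mul_one]
    rw [rowSpan_mul, rowSpan_chart]
    rw [Matrix.det_diagonal]
    exact Finset.prod_ne_zero_iff.2 fun a _ => inv_ne_zero (hβ V a)
  · intro V W h
    obtain ⟨t, ht⟩ := toX_eq_iff.1 h
    ext a i
    rw [hNa, hNa, hsmap V W t ht, chart_torusScale I ht, chart_torusScale I ht]
    have h1 : ∀ i, (t i : K) ≠ 0 := fun i => Units.ne_zero _
    have := h1 j₀
    have := h1 (I a)
    have := h1 i
    have := hβ V a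
    have := hs0 V i
    field_simp
  · intro V
    ext
    simp only [hs, Units.val_mk0, Units.val_one]
    rw [dif_neg (lt_irrefl k), div_self (hβ V a₀)]
  · intro V W t h i
    ext
    simpa using hsmap V W t h i

namespace Normalization

variable (ν : Normalization K k n)

theorem minor_mat_ne_zero (V : GrOpen K k n) (I : Fin k ↪o Fin n) : minor (ν.mat V) I ≠ 0 := by
  have h := ν.eq_map V
  rw [map_rowSpan] at h
  have := (plucker_ne_zero_iff V.1 h I).1 (V.2 I)
  rw [minor_mul_diagonal] at this
  exact left_ne_zero_of_mul this

theorem plucker_div (V : GrOpen K k n) (I J : Fin k ↪o Fin n) :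
    plucker V.1 I / plucker V.1 J = minor (ν.mat V) I / minor (ν.mat V) J *
      ((∏ a, (ν.scale V (I a) : K)) * ∏ a, (ν.scale V (J a) : K)⁻¹) := by
  have h := ν.eq_map V
  rw [map_rowSpan] at h
  obtain ⟨c, hc, hm⟩ := exists_minor_eq V.1 h
  rw [plucker_eq_minor, plucker_eq_minor, ← mul_div_mul_left _ _ hc, ← hm, ← hm,
    minor_mul_diagonal, minor_mul_diagonal, mul_div_mul_comm, Finset.prod_inv_distrib,
    div_eq_mul_inv (∏ a, _)]

theorem minor_div_mem (I J : Fin k ↪o Fin n) :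
    (fun V => minor (ν.mat V) I / minor (ν.mat V) J) ∈ grRing K k n := by
  have h1 := (grRing K k n).prod_mem (t := Finset.univ)
    (f := fun (a : Fin k) V => (ν.scale V (I a) : K)⁻¹) fun a _ => ν.scale_inv_mem _
  have h2 := (grRing K k n).prod_mem (t := Finset.univ)
    (f := fun (a : Fin k) V => (ν.scale V (J a) : K)) fun a _ => ν.scale_mem _
  convert mul_mem (plucker_div_mem I J) (mul_mem h1 h2) using 1
  funext V
  simp only [Pi.mul_apply, Finset.prod_apply, ν.plucker_div, Finset.prod_inv_distrib]
  have h3 : ∏ a, (ν.scale V (I a) : K) ≠ 0 := Finset.prod_ne_zero_iff.2 fun _ _ => Units.ne_zero _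
  have h4 : ∏ a, (ν.scale V (J a) : K) ≠ 0 := Finset.prod_ne_zero_iff.2 fun _ _ => Units.ne_zero _
  have := ν.minor_mat_ne_zero V J
  field_simp

/-- The diagonal form on the normalized matrix. -/
theorem isotropic_mat (V : GrOpen K k n) (x : Fin n → K) :
    Isotropic x V.1.1 ↔ Isotropic (fun i => x i * (ν.scale V i : K) ^ 2) (rowSpan (ν.mat V)) := by
  rw [ν.eq_map V, isotropic_map_torusScale]

end Normalization

end Normalization


section Forms

variable {K : Type*} [Field K] {k n : ℕ}

/-! ### The space of diagonal forms vanishing on a subspace -/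

/-- Up to scalars, `x` is the only diagonal form vanishing on `V`. -/
def IsUniqueForm (x : Fin n → K) (V : Submodule K (Fin n → K)) : Prop :=
  Isotropic x V ∧ ∀ y, Isotropic y V → ∃ c : K, y = c • x

theorem det_updateRow_eq_sum {m : Type*} [Fintype m] [DecidableEq m] (T : Matrix m m K) (r : m)
    (w : m → K) : (T.updateRow r w).det = ∑ i, w i * T.adjugate i r := by
  rw [Matrix.det_eq_sum_mul_adjugate_row _ r]
  refine Finset.sum_congr rfl fun i _ => ?_
  rw [Matrix.adjugate_apply, Matrix.updateRow_idem, Matrix.updateRow_self, Matrix.adjugate_apply]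

/-- The sum is the determinant of `T` with row `r` replaced by `w`, and `x` lies in the kernel of
that matrix. -/
theorem sum_mul_adjugate_eq_zero {m : Type*} [Fintype m] [DecidableEq m] {T : Matrix m m K}
    {x : m → K} (hx : x ≠ 0) (h : T.mulVec x = 0) (r : m) {w : m → K} (hw : w ⬝ᵥ x = 0) :
    ∑ i, w i * T.adjugate i r = 0 := by
  rw [← det_updateRow_eq_sum]
  refine Matrix.exists_mulVec_eq_zero_iff.1 ⟨x, hx, ?_⟩
  funext p
  by_cases hp : p = r
  · subst hp
    simpa [Matrix.mulVec] using hw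
  · have := congrFun h p
    simpa [Matrix.mulVec, Matrix.updateRow_ne hp] using this

/-- Columns of the adjugate are proportional to any nonzero kernel vector: test against `x j • e_i -
x i • e_j`, which is orthogonal to `x`. -/
theorem mul_adjugate_comm {m : Type*} [Fintype m] [DecidableEq m] {T : Matrix m m K}
    {x : m → K} (h : T.mulVec x = 0) (i j r : m) :
    x j * T.adjugate i r = x i * T.adjugate j r := by
  by_cases hx : x = 0
  · simp [hx]
  have := sum_mul_adjugate_eq_zero hx h r (w := x j • Pi.single i 1 - x i • Pi.single j 1) (by
    rw [sub_dotProduct, smul_dotProduct, smul_dotProduct]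
    simp [mul_comm])
  simp only [Pi.sub_apply, Pi.smul_apply, smul_eq_mul, sub_mul, Finset.sum_sub_distrib,
    mul_assoc, ← Finset.mul_sum] at this
  simpa [Pi.single_apply, sub_eq_zero] using this

/-- A square matrix of `n` of the linear conditions for a diagonal form to vanish on the row
space of `X`. -/
def condMatrix (X : Matrix (Fin k) (Fin n) K) (R : Fin n → Fin k × Fin k) :
    Matrix (Fin n) (Fin n) K :=
  Matrix.of fun r i => X (R r).1 i * X (R r).2 i

theorem condMatrix_mulVec {X : Matrix (Fin k) (Fin n) K} {x : Fin n → K}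
    (h : Isotropic x (rowSpan X)) (R : Fin n → Fin k × Fin k) : (condMatrix X R).mulVec x = 0 := by
  funext r
  have := isotropic_rowSpan_iff.1 h (R r).1 (R r).2
  rw [Pi.zero_apply, ← this]
  simp only [Matrix.mulVec, dotProduct]
  refine Finset.sum_congr rfl fun i _ => ?_
  rw [condMatrix, Matrix.of_apply]
  ring

/-- Since `x` satisfies every condition, a column of cofactors of `n` chosen conditions satisfies
all of them, not only the chosen ones. -/
theorem sum_adjugate_condMatrix {X : Matrix (Fin k) (Fin n) K} {x : Fin n → K} (hx : x ≠ 0)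
    (h : Isotropic x (rowSpan X)) (R : Fin n → Fin k × Fin k) (r : Fin n) (a b : Fin k) :
    ∑ i, X a i * X b i * (condMatrix X R).adjugate i r = 0 := by
  refine sum_mul_adjugate_eq_zero hx (condMatrix_mulVec h R) r (w := fun i => X a i * X b i) ?_
  rw [← isotropic_rowSpan_iff.1 h a b]
  exact Finset.sum_congr rfl fun i _ => by ring

/-- Uniqueness means that the conditions span the hyperplane orthogonal to `x`. As `x i₀ ≠ 0`, the
conditions together with the unit vector at `i₀` span everything. A basis taken from them must use
that unit vector, and its determinant is the desired cofactor; proportionality to `x` spreads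
nonvanishing to all `i`. -/
theorem exists_adjugate_ne_zero (hk : 0 < k) {X : Matrix (Fin k) (Fin n) K} {x : Fin n → K}
    (hx : ∀ i, x i ≠ 0) (hn : 0 < n) (h : IsUniqueForm x (rowSpan X)) :
    ∃ (R : Fin n → Fin k × Fin k) (r : Fin n), ∀ i, (condMatrix X R).adjugate i r ≠ 0 := by
  classical
  set i₀ : Fin n := ⟨0, hn⟩
  suffices ∃ (R : Fin n → Fin k × Fin k) (r : Fin n), (condMatrix X R).adjugate i₀ r ≠ 0 by
    obtain ⟨R, r, hr⟩ := this
    refine ⟨R, r, fun i hi => ?_⟩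
    have := mul_adjugate_comm (condMatrix_mulVec h.1 R) i₀ i r
    rw [hi, mul_zero] at this
    exact mul_ne_zero (hx i) hr this
  set row : Fin k × Fin k → Fin n → K := fun p i => X p.1 i * X p.2 i with hrow
  set w : Fin n → K := Pi.single i₀ 1 with hw
  have hspan : Submodule.span K (Set.range row ∪ {w}) = ⊤ := by
    by_contra hne
    obtain ⟨f, hf0, hf⟩ := Submodule.exists_le_ker_of_lt_top _ (lt_top_iff_ne_top.2 hne)
    have hfv : ∀ v, f v = ∑ i, v i * f (Pi.single i 1) := by
      intro v
      rw [f.pi_apply_eq_sum_univ v]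
      refine Finset.sum_congr rfl fun i _ => ?_
      rw [smul_eq_mul]
      congr 2
      funext j
      simp [Pi.single_apply, eq_comm]
    obtain ⟨c, hc⟩ := h.2 (fun i => f (Pi.single i 1)) <| isotropic_rowSpan_iff.2 fun a b => by
      have h1 : row (a, b) ∈ LinearMap.ker f :=
        hf (Submodule.subset_span (Or.inl ⟨(a, b), rfl⟩))
      rw [LinearMap.mem_ker, hfv] at h1
      rw [← h1]
      exact Finset.sum_congr rfl fun i _ => by simp only [hrow]; ring
    have h2 : f w = 0 := hf (Submodule.subset_span (Or.inr rfl))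
    have h3 := congrFun hc i₀
    change f w = c * x i₀ at h3
    rw [h2, zero_eq_mul, or_iff_left (hx _)] at h3
    refine hf0 (LinearMap.ext fun v => ?_)
    have h4 : ∀ i, f (Pi.single i 1) = 0 := fun i => by
      have := congrFun hc i
      rwa [h3, zero_smul] at this
    rw [hfv]
    simp [h4]
  obtain ⟨f', hf', -, hli'⟩ := Submodule.exists_fun_fin_finrank_span_eq K (Set.range row ∪ {w})
  have hfr : Module.finrank K (Submodule.span K (Set.range row ∪ {w})) = n := by
    rw [hspan, finrank_top, Module.finrank_fin_fun]
  obtain ⟨f, hf, hli⟩ : ∃ f : Fin n → Fin n → K, (∀ i, f i ∈ Set.range row ∪ {w}) ∧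
      LinearIndependent K f :=
    ⟨fun i => f' (Fin.cast hfr.symm i), fun i => hf' _, hli'.comp _ (Fin.cast_injective _)⟩
  have hdet : (Matrix.of f).det ≠ 0 := by
    have : IsUnit (Matrix.of f) := Matrix.linearIndependent_rows_iff_isUnit.1 hli
    exact ((Matrix.isUnit_iff_isUnit_det _).1 this).ne_zero
  have hR : ∀ p, ∃ q, f p ∈ Set.range row → f p = row q := by
    intro p
    by_cases hp : f p ∈ Set.range row
    · obtain ⟨q, hq⟩ := hp
      exact ⟨q, fun _ => hq.symm⟩
    -- An arbitrary condition: this row of `condMatrix` is replaced by the unit vector when the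
    -- cofactor is taken.
    · exact ⟨(⟨0, hk⟩, ⟨0, hk⟩), fun h => absurd h hp⟩
  choose R hR using hR
  have hex : ∃ r, f r ∉ Set.range row := by
    by_contra! hall
    refine hdet (Matrix.exists_mulVec_eq_zero_iff.1
      ⟨x, fun h0 => hx i₀ (congrFun h0 i₀), ?_⟩)
    have : Matrix.of f = condMatrix X R := by
      ext p i
      rw [Matrix.of_apply, hR p (hall p)]
      rfl
    rw [this]
    exact condMatrix_mulVec h.1 R
  obtain ⟨r, hr⟩ := hex
  have hrw : f r = w := (hf r).resolve_left hr
  refine ⟨R, r, ?_⟩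
  rw [Matrix.adjugate_apply]
  convert hdet using 2
  ext p i
  by_cases hp : p = r
  · subst hp
    rw [Matrix.updateRow_self, Matrix.of_apply, hrw]
  · rw [Matrix.updateRow_ne hp, Matrix.of_apply, hR p]
    · rfl
    · refine (hf p).resolve_right fun hpw => hp (hli.injective ?_)
      rw [hrw]
      exact hpw

/-- Both `x` and any competing `y` are proportional to the same nonzero column of cofactors. -/
theorem isUniqueForm_of_adjugate_ne_zero {X : Matrix (Fin k) (Fin n) K} {x : Fin n → K}
    (hx : Isotropic x (rowSpan X)) {R : Fin n → Fin k × Fin k} {i₀ r : Fin n}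
    (hi₀ : x i₀ ≠ 0) (h : (condMatrix X R).adjugate i₀ r ≠ 0) : IsUniqueForm x (rowSpan X) := by
  refine ⟨hx, fun y hy => ⟨y i₀ / x i₀, funext fun j => ?_⟩⟩
  have h1 := mul_adjugate_comm (condMatrix_mulVec hx R) i₀ j r
  have h2 := mul_adjugate_comm (condMatrix_mulVec hy R) i₀ j r
  rw [Pi.smul_apply, smul_eq_mul, div_mul_eq_mul_div, eq_div_iff hi₀]
  apply mul_right_cancel₀ h
  linear_combination x i₀ * h2 - y i₀ * h1

theorem isUniqueForm_map_torusScale {x : Fin n → K} {V : Submodule K (Fin n → K)}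
    (t : Fin n → Kˣ) : IsUniqueForm x (V.map (torusScale t)) ↔
      IsUniqueForm (fun i => x i * (t i : K) ^ 2) V := by
  have ht : ∀ i, (t i : K) ^ 2 ≠ 0 := fun i => pow_ne_zero _ (Units.ne_zero _)
  simp only [IsUniqueForm, isotropic_map_torusScale]
  refine and_congr_right fun _ => ⟨fun h y hy => ?_, fun h y hy => ?_⟩
  · obtain ⟨c, hc⟩ := h (fun i => y i / (t i : K) ^ 2) (by
      simpa only [div_mul_cancel₀ _ (ht _)] using hy)
    refine ⟨c, funext fun i => ?_⟩
    have := congrFun hc i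
    simp only [Pi.smul_apply, smul_eq_mul] at this ⊢
    rw [div_eq_iff (ht i)] at this
    rw [this, mul_assoc]
  · obtain ⟨c, hc⟩ := h _ hy
    refine ⟨c, funext fun i => mul_right_cancel₀ (ht i) ?_⟩
    have := congrFun hc i
    simp only [Pi.smul_apply, smul_eq_mul] at this ⊢
    rw [this, mul_assoc]

/-- If some isotropic subspace for the form `u` is isotropic for no other diagonal form, then there
is one with nonzero Plücker coordinates, provided that isotropic subspaces with nonzero Plücker
coordinates exist. -/
theorem exists_isUniqueForm [Infinite K] (h2 : (2 : K) ≠ 0) (hk : 0 < k) (hkn : k ≤ n)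
    (u : Fin n → Kˣ) (V₀ : GrOpen K k n) (h₀ : V₀.1 ∈ OGr u) (X : Matrix (Fin k) (Fin n) K)
    (hX : IsUniqueForm (fun i => (u i : K)) (rowSpan X)) (I : Fin k ↪o Fin n)
    (hI : minor X I ≠ 0) :
    ∃ V : GrOpen K k n, IsUniqueForm (fun i => (u i : K)) V.1.1 := by
  have hn : 0 < n := hk.trans_le hkn
  rw [mem_OGr_iff, ← rowSpan_stdMatrix] at h₀
  obtain ⟨Z, ε, hZ, hiso, hε, hZ0, hZ1⟩ := exists_isotropic_curve h2 u _ _ h₀ hX.1 I (V₀.2 _) hI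
  rw [rowSpan_stdMatrix] at hZ0
  have hu1 : IsUniqueForm (fun i => (u i : K)) (rowSpan (Z 1)) := by
    rw [hZ1, isUniqueForm_map_torusScale]
    convert hX using 3 with i
    rcases hε i with h | h <;> simp [h]
  obtain ⟨R, r, hR⟩ := exists_adjugate_ne_zero hk (fun i => (u i).ne_zero) hn hu1
  have hmin : ∀ f : Fin k → Fin n, (fun t => minor (Z t) f) ∈ polyFun K := fun f =>
    det_mem _ _ fun i j => hZ i (f j)
  have hPp : (fun t => ∏ I : Fin k ↪o Fin n, minor (Z t) I) ∈ polyFun K := by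
    have := (polyFun K).prod_mem (t := Finset.univ)
      (f := fun (I : Fin k ↪o Fin n) t => minor (Z t) I) fun I _ => hmin I
    convert this using 1
    funext t
    simp
  have hA : (fun t => (condMatrix (Z t) R).adjugate ⟨0, hn⟩ r) ∈ polyFun K :=
    adjugate_mem _ _ (fun i j => mul_mem (hZ _ _) (hZ _ _)) _ _
  have e2 : ∏ I : Fin k ↪o Fin n, minor (Z 0) I ≠ 0 :=
    Finset.prod_ne_zero_iff.2 fun I _ => (plucker_ne_zero_iff V₀.1 hZ0.symm I).1 (V₀.2 I)
  -- The Plücker coordinates are nonzero at parameter `0` and the cofactor certifying uniqueness at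
  -- parameter `1`.
  obtain ⟨-, t, ht⟩ := mul_ne_zero_of_mem_polyFun hPp hA e2 (hR ⟨0, hn⟩)
  obtain ⟨V, hV⟩ := exists_grOpen hkn (Z t) fun I =>
    Finset.prod_ne_zero_iff.1 (left_ne_zero_of_mul ht) I (Finset.mem_univ I)
  refine ⟨V, ?_⟩
  rw [hV]
  exact isUniqueForm_of_adjugate_ne_zero (hiso t) (u ⟨0, hn⟩).ne_zero (right_ne_zero_of_mul ht)

end Forms


section Configuration

variable {K : Type*} [Field K] {k : ℕ} {ι : Type*} [DecidableEq ι]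

/-! ### Vectors whose squares satisfy exactly one linear relation -/

/-- The squares of the vectors `v i`, `i ∈ T`, satisfy the linear relation with coefficients `u i`,
and no other one; moreover, these vectors span the whole space. -/
structure IsSelfDualConfiguration (u : ι → K) (T : Finset ι) (v : ι → Fin k → K) : Prop where
  relation : ∀ a b, ∑ i ∈ T, u i * (v i a * v i b) = 0
  unique : ∀ x : ι → K, (∀ a b, ∑ i ∈ T, x i * (v i a * v i b) = 0) →
    ∃ c : K, ∀ i ∈ T, x i = c * u i
  span_eq : Submodule.span K (v '' T) = ⊤

/-- Take the Householder reflection in `w = (t, 1, …, 1)`. The conditions on `t` say that `w` has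
nonzero entries and nonzero square length `s`, and that no diagonal entry `1 - 2 * w a ^ 2 / s`
vanishes. -/
theorem exists_orthogonal_forall_ne_zero [Infinite K] (h2 : (2 : K) ≠ 0) (hk : 0 < k) :
    ∃ H : Matrix (Fin k) (Fin k) K, H * H.transpose = 1 ∧ ∀ a b, H a b ≠ 0 := by
  classical
  obtain ⟨t, ht0, ht1, ht2, ht3⟩ : ∃ t : K, t ≠ 0 ∧ t ^ 2 + (k - 1) ≠ 0 ∧ t ^ 2 + (k - 3) ≠ 0 ∧
      t ^ 2 + (1 - k) ≠ 0 := by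
    by_contra! hall
    have hne : ∀ c : K, (Polynomial.X ^ 2 + Polynomial.C c) ≠ 0 := fun c =>
      (Polynomial.monic_X_pow_add_C c two_ne_zero).ne_zero
    have : (Polynomial.X * (Polynomial.X ^ 2 + Polynomial.C ((k : K) - 1)) *
        (Polynomial.X ^ 2 + Polynomial.C ((k : K) - 3)) *
        (Polynomial.X ^ 2 + Polynomial.C (1 - (k : K)))) = 0 := by
      refine Polynomial.funext fun t => ?_
      simp only [Polynomial.eval_mul, Polynomial.eval_add, Polynomial.eval_pow,
        Polynomial.eval_X, Polynomial.eval_C, Polynomial.eval_zero]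
      by_cases h0 : t = 0
      · simp [h0]
      by_cases h1 : t ^ 2 + ((k : K) - 1) = 0
      · simp [h1]
      by_cases h3 : t ^ 2 + ((k : K) - 3) = 0
      · simp [h3]
      rw [hall t h0 h1 h3, mul_zero]
    exact mul_ne_zero (mul_ne_zero (mul_ne_zero Polynomial.X_ne_zero (hne _)) (hne _)) (hne _) this
  set a₀ : Fin k := ⟨0, hk⟩
  set w : Fin k → K := fun a => if a = a₀ then t else 1 with hw
  set s : K := t ^ 2 + (k - 1) with hs
  have hsum : ∑ a, w a ^ 2 = s := by
    rw [← Finset.add_sum_erase _ _ (Finset.mem_univ a₀)]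
    have : ∑ a ∈ Finset.univ.erase a₀, w a ^ 2 = ∑ a ∈ Finset.univ.erase a₀, (1 : K) :=
      Finset.sum_congr rfl fun a ha => by simp [hw, Finset.ne_of_mem_erase ha]
    rw [this, Finset.sum_const, Finset.card_erase_of_mem (Finset.mem_univ _), Finset.card_univ,
      Fintype.card_fin, nsmul_eq_mul, Nat.cast_sub hk]
    simp [hw, hs]
  have hw0 : ∀ a, w a ≠ 0 := by
    intro a
    simp only [hw]
    split_ifs
    · exact ht0
    · exact one_ne_zero
  have hw2 : ∀ a, s - 2 * w a ^ 2 ≠ 0 := by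
    intro a
    simp only [hw]
    split_ifs
    · intro h
      apply ht3
      linear_combination -h
    · intro h
      apply ht2
      linear_combination h
  refine ⟨Matrix.of fun a b => (if a = b then 1 else 0) - 2 / s * (w a * w b), ?_, ?_⟩
  · ext a b
    rw [Matrix.mul_apply, Matrix.one_apply]
    simp only [Matrix.of_apply, Matrix.transpose_apply]
    have : ∀ c, ((if a = c then (1 : K) else 0) - 2 / s * (w a * w c)) *
        ((if b = c then 1 else 0) - 2 / s * (w b * w c)) =
        (if a = c then (if b = c then 1 else 0) else 0) -
          (if a = c then 2 / s * (w b * w c) else 0) - (if b = c then 2 / s * (w a * w c) else 0) +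
          (2 / s) ^ 2 * (w a * w b) * w c ^ 2 := by
      intro c
      split_ifs <;> ring
    simp only [this, Finset.sum_add_distrib, Finset.sum_sub_distrib, Finset.sum_ite_eq,
      Finset.mem_univ, if_true, ← Finset.mul_sum, hsum, @eq_comm _ b a]
    field_simp
    ring
  · intro a b
    rw [Matrix.of_apply]
    split_ifs with h
    · subst h
      have := hw2 a
      intro h
      apply this
      field_simp at h
      linear_combination h
    · rw [zero_sub, neg_ne_zero]
      exact mul_ne_zero (div_ne_zero h2 ht1) (mul_ne_zero (hw0 a) (hw0 b))

/-- Use the standard basis and the columns of `H`, rescaled to absorb `u`; the relation is `H Hᵀ =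
1`. Any relation reads `D₁ H = -H D₂` with `D₁`, `D₂` diagonal, and as `H` has no zero entry, every
entry of `D₁` is minus every entry of `D₂`. -/
theorem exists_isSelfDualConfiguration_base [Infinite K] (h2 : (2 : K) ≠ 0) (hk : 0 < k)
    {u : ι → K} (α β : Fin k ↪ ι) (hαβ : ∀ a b, α a ≠ β b) {c d : Fin k → K}
    (hc : ∀ a, c a ≠ 0) (hd : ∀ a, d a ≠ 0) (huc : ∀ a, u (α a) = c a ^ 2)
    (hud : ∀ a, u (β a) = -d a ^ 2) :
    ∃ v : ι → Fin k → K,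
      IsSelfDualConfiguration u (Finset.univ.map α ∪ Finset.univ.map β) v := by
  obtain ⟨H, hH, hH0⟩ := exists_orthogonal_forall_ne_zero (K := K) h2 hk
  set p : Fin k → Fin k → K := fun a => (c a)⁻¹ • Pi.single a 1 with hp
  set q : Fin k → Fin k → K := fun a => (d a)⁻¹ • H.col a with hq
  obtain ⟨v, hvα, hvβ⟩ : ∃ v : ι → Fin k → K, (∀ a, v (α a) = p a) ∧ ∀ a, v (β a) = q a := by
    refine ⟨Function.extend α p (Function.extend β q 0), fun a => α.injective.extend_apply _ _ _,
      fun a => ?_⟩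
    rw [Function.extend_apply', β.injective.extend_apply]
    rintro ⟨b, hb⟩
    exact hαβ b a hb
  have hdisj : Disjoint (Finset.univ.map α) (Finset.univ.map β) := by
    rw [Finset.disjoint_left]
    simp only [Finset.mem_map, Finset.mem_univ, true_and]
    rintro _ ⟨a, rfl⟩ ⟨b, hb⟩
    exact hαβ a b hb.symm
  have hsum : ∀ (x : ι → K) a b, ∑ i ∈ Finset.univ.map α ∪ Finset.univ.map β,
      x i * (v i a * v i b) = (Matrix.diagonal (fun e => x (α e) / c e ^ 2) +
        H * Matrix.diagonal (fun e => x (β e) / d e ^ 2) * H.transpose) a b := by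
    intro x a b
    rw [Finset.sum_union hdisj, Finset.sum_map, Finset.sum_map, Matrix.add_apply,
      mul_diagonal_mul_transpose_apply]
    simp only [hvα, hvβ, hp, hq]
    congr 1
    · rw [Finset.sum_eq_single a]
      · by_cases hab : a = b
        · subst hab
          have := hc a
          simp
          field_simp
        · simp [hab]
      · intro e _ he
        simp [he.symm]
      · simp
    · refine Finset.sum_congr rfl fun e _ => ?_
      have := hd e
      simp only [Pi.smul_apply, Matrix.col_apply, smul_eq_mul]
      field_simp
  refine ⟨v, ⟨fun a b => ?_, fun x hx => ?_, ?_⟩⟩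
  · rw [hsum]
    have h1 : (fun e => u (α e) / c e ^ 2) = 1 := by
      funext e
      rw [huc, div_self (pow_ne_zero _ (hc e)), Pi.one_apply]
    have h2 : (fun e => u (β e) / d e ^ 2) = -1 := by
      funext e
      rw [hud, neg_div, div_self (pow_ne_zero _ (hd e)), Pi.neg_apply, Pi.one_apply]
    have h3 : Matrix.diagonal (-1 : Fin k → K) = -1 := by
      ext a b
      by_cases hab : a = b
      · subst hab; simp
      · simp [hab]
    rw [h1, h2, h3, Matrix.mul_neg, Matrix.mul_one, Matrix.neg_mul, hH]
    have : Matrix.diagonal (1 : Fin k → K) = 1 := Matrix.diagonal_one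
    rw [this, add_neg_cancel, Matrix.zero_apply]
  · have hzero : Matrix.diagonal (fun e => x (α e) / c e ^ 2) +
        H * Matrix.diagonal (fun e => x (β e) / d e ^ 2) * H.transpose = 0 := by
      ext a b
      rw [← hsum, hx, Matrix.zero_apply]
    have hmul := congrArg (· * H) hzero
    have hH' : H.transpose * H = 1 := mul_eq_one_comm.1 hH
    simp only [Matrix.add_mul, Matrix.mul_assoc, hH', Matrix.mul_one, Matrix.zero_mul] at hmul
    have key : ∀ a b, x (α a) / c a ^ 2 = - (x (β b) / d b ^ 2) := by
      intro a b
      have := congrFun (congrFun hmul a) b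
      rw [Matrix.add_apply, Matrix.diagonal_mul, Matrix.mul_diagonal, Matrix.zero_apply] at this
      apply mul_right_cancel₀ (hH0 a b)
      linear_combination this
    set a₀ : Fin k := ⟨0, hk⟩
    refine ⟨x (α a₀) / c a₀ ^ 2, fun i hi => ?_⟩
    rw [Finset.mem_union, Finset.mem_map, Finset.mem_map] at hi
    rcases hi with ⟨a, -, rfl⟩ | ⟨b, -, rfl⟩
    · rw [huc, key a₀ a₀, ← key a a₀, div_mul_cancel₀ _ (pow_ne_zero _ (hc a))]
    · rw [hud, key a₀ b, neg_mul_neg, div_mul_cancel₀ _ (pow_ne_zero _ (hd b))]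
  · rw [eq_top_iff, ← (Pi.basisFun K (Fin k)).span_eq, Submodule.span_le]
    rintro _ ⟨a, rfl⟩
    have h1 : v (α a) ∈ Submodule.span K
        (v '' (Finset.univ.map α ∪ Finset.univ.map β : Finset ι)) :=
      Submodule.subset_span ⟨α a, by simp, rfl⟩
    have h2 := Submodule.smul_mem _ (c a) h1
    rw [hvα] at h2
    simpa [hp, smul_smul, hc a] using h2

/-- The symmetric product of two vectors. -/
def symProd (v w : Fin k → K) : Matrix (Fin k) (Fin k) K :=
  Matrix.vecMulVec v w + Matrix.vecMulVec w v

theorem symProd_mem_of_span {S : Submodule K (Matrix (Fin k) (Fin k) K)} {s : Set (Fin k → K)}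
    (hs : Submodule.span K s = ⊤) (h : ∀ v ∈ s, ∀ w ∈ s, symProd v w ∈ S) (v w : Fin k → K) :
    symProd v w ∈ S := by
  have hv : v ∈ Submodule.span K s := by rw [hs]; trivial
  have hw : w ∈ Submodule.span K s := by rw [hs]; trivial
  have hz : ∀ v : Fin k → K, symProd 0 v = 0 ∧ symProd v 0 = 0 := by
    intro v; constructor <;> · ext; simp [symProd]
  induction hv, hw using Submodule.span_induction₂ with
  | mem_mem v w hv hw => exact h v hv w hw
  | zero_left => rw [(hz _).1]; exact S.zero_mem
  | zero_right => rw [(hz _).2]; exact S.zero_mem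
  | add_left x y z _ _ _ h1 h2 =>
    have : symProd (x + y) z = symProd x z + symProd y z := by
      ext; simp [symProd, Matrix.vecMulVec_apply]; ring
    rw [this]; exact S.add_mem h1 h2
  | add_right x y z _ _ _ h1 h2 =>
    have : symProd x (y + z) = symProd x y + symProd x z := by
      ext; simp [symProd, Matrix.vecMulVec_apply]; ring
    rw [this]; exact S.add_mem h1 h2
  | smul_left r x y _ _ h1 =>
    have : symProd (r • x) y = r • symProd x y := by
      ext; simp [symProd, Matrix.vecMulVec_apply]; ring
    rw [this]; exact S.smul_mem _ h1
  | smul_right r x y _ _ h1 =>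
    have : symProd x (r • y) = r • symProd x y := by
      ext; simp [symProd, Matrix.vecMulVec_apply]; ring
    rw [this]; exact S.smul_mem _ h1

theorem choose_two_le_finrank (h2 : (2 : K) ≠ 0) {S : Submodule K (Matrix (Fin k) (Fin k) K)}
    (hS : ∀ v w, symProd v w ∈ S) : (k + 1).choose 2 ≤ Module.finrank K S := by
  set g : {p : Fin k × Fin k // p.1 ≤ p.2} → S := fun p =>
    ⟨symProd (Pi.single p.1.1 1) (Pi.single p.1.2 1), hS _ _⟩ with hg
  have hli : LinearIndependent K g := by
    rw [Fintype.linearIndependent_iff]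
    intro x hx p
    have h := congrArg (fun M : S => (M : Matrix (Fin k) (Fin k) K) p.1.1 p.1.2) hx
    simp only [Submodule.coe_sum, Submodule.coe_smul, Submodule.coe_zero, Matrix.sum_apply,
      Matrix.smul_apply, Matrix.zero_apply, smul_eq_mul, hg] at h
    rw [Finset.sum_eq_single p] at h
    · rcases mul_eq_zero.1 h with h | h
      · exact h
      · exfalso
        obtain ⟨⟨a, b⟩, hab⟩ := p
        by_cases hne : a = b
        · subst hne
          simp only [symProd, Matrix.add_apply, Matrix.vecMulVec_apply, Pi.single_eq_same] at h
          apply h2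
          linear_combination h
        · simp [symProd, Matrix.vecMulVec_apply, hne] at h
    · rintro ⟨⟨a, b⟩, hab⟩ - hne
      obtain ⟨⟨a', b'⟩, hab'⟩ := p
      simp only [ne_eq, Subtype.mk.injEq, Prod.mk.injEq, not_and] at hne hab hab'
      apply mul_eq_zero_of_right
      simp only [symProd, Matrix.add_apply, Matrix.vecMulVec_apply, Pi.single_apply]
      split_ifs <;> simp <;> omega
    · simp
  have := hli.fintype_card_le_finrank
  rwa [← Fintype.card_congr (Sym2.sortEquiv (α := Fin k)), Sym2.card, Fintype.card_fin] at this

/-- Otherwise the squares would span all symmetric products, a space of dimension at least `(k +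
1).choose 2`. Being no more numerous than that, they would be independent, contradicting their
relation. -/
theorem exists_symProd_not_mem (h2 : (2 : K) ≠ 0) (hk : 0 < k) {u : ι → K} (hu : ∀ i, u i ≠ 0)
    {T : Finset ι} {v : ι → Fin k → K} (h : IsSelfDualConfiguration u T v)
    (hT : T.card ≤ (k + 1).choose 2) :
    ∃ i ∈ T, ∃ j ∈ T, i ≠ j ∧ ∀ x : ι → K,
      ∑ l ∈ T, x l • Matrix.vecMulVec (v l) (v l) ≠ symProd (v i) (v j) := by
  by_contra! hall
  set f : T → Matrix (Fin k) (Fin k) K := fun l => Matrix.vecMulVec (v l) (v l) with hf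
  have hsum : ∀ x : ι → K, ∑ l ∈ T, x l • Matrix.vecMulVec (v l) (v l) ∈
      Submodule.span K (Set.range f) := fun x => Submodule.sum_mem _ fun l hl =>
        Submodule.smul_mem _ _ (Submodule.subset_span ⟨⟨l, hl⟩, rfl⟩)
  have hS : ∀ x y, symProd x y ∈ Submodule.span K (Set.range f) := by
    refine symProd_mem_of_span h.span_eq ?_
    rintro _ ⟨i, hi, rfl⟩ _ ⟨j, hj, rfl⟩
    by_cases hij : i = j
    · subst hij
      rw [symProd, ← two_smul K]
      exact Submodule.smul_mem _ _ (Submodule.subset_span ⟨⟨i, hi⟩, rfl⟩)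
    · obtain ⟨x, hx⟩ := hall i hi j hj hij
      rw [← hx]
      exact hsum x
  have h3 := (Fintype.card_coe T).trans_le (hT.trans (choose_two_le_finrank h2 hS))
  have hli : LinearIndependent K f := linearIndependent_iff_card_le_finrank_span.2 h3
  rw [Fintype.linearIndependent_iff] at hli
  have hne : T.Nonempty := by
    rw [Finset.nonempty_iff_ne_empty]
    rintro rfl
    have := h.span_eq
    simp only [Finset.coe_empty, Set.image_empty, Submodule.span_empty] at this
    have h4 : Module.finrank K (⊤ : Submodule K (Fin k → K)) = k := by
      rw [finrank_top, Module.finrank_fin_fun]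
    rw [← this, finrank_bot] at h4
    omega
  obtain ⟨i, hi⟩ := hne
  refine hu i (hli (fun l => u l) ?_ ⟨i, hi⟩)
  rw [Finset.sum_coe_sort T (fun l => u l • Matrix.vecMulVec (v l) (v l))]
  ext a b
  rw [Matrix.sum_apply, Matrix.zero_apply, ← h.relation a b]
  simp [Matrix.vecMulVec_apply]

end Configuration


/-! ### Enlarging a configuration by one vector -/

section Configuration

variable {K : Type*} [Field K] {k : ℕ} {ι : Type*} [DecidableEq ι]

/-- In terms of symmetric squares, `x v_i² + y v_j² = x c² (v_i - κ v_j)² + y d² v_j² + z e² (v_i +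
v_j)²`; `hsq` makes this solvable. The product `v_i v_j` is chosen outside the span of the old
squares. In a new relation its coefficient must therefore vanish, and what is left is a multiple of
the old relation. -/
theorem exists_isSelfDualConfiguration_insert (h2 : (2 : K) ≠ 0) (hk : 0 < k)
    (hsq : ∀ x y z : K, x ≠ 0 → y ≠ 0 → z ≠ 0 → ∃ c d e : K, c ≠ 0 ∧ d ≠ 0 ∧ e ≠ 0 ∧
      x * c ^ 2 = x - z * e ^ 2 ∧ y * d ^ 2 * c ^ 2 = y * c ^ 2 - z * e ^ 2)
    {u : ι → K} (hu : ∀ i, u i ≠ 0) {T : Finset ι} {v : ι → Fin k → K}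
    (h : IsSelfDualConfiguration u T v) (hT : T.card ≤ (k + 1).choose 2) {i₀ : ι} (hi₀ : i₀ ∉ T) :
    ∃ v' : ι → Fin k → K, IsSelfDualConfiguration u (insert i₀ T) v' := by
  obtain ⟨i, hi, j, hj, hij, hnot⟩ := exists_symProd_not_mem h2 hk hu h hT
  obtain ⟨T', hiT, hjT, rfl⟩ : ∃ T', i ∉ insert j T' ∧ j ∉ T' ∧ T = insert i (insert j T') := by
    refine ⟨(T.erase i).erase j, ?_, by simp, ?_⟩
    · simp [hij]
    · rw [Finset.insert_erase (Finset.mem_erase.2 ⟨hij.symm, hj⟩), Finset.insert_erase hi]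
  obtain ⟨c, d, e, hc, hd, he, hx, hy⟩ := hsq (u i) (u j) (u i₀) (hu i) (hu j) (hu i₀)
  set x := u i
  set y := u j
  set z := u i₀
  have hx0 : x ≠ 0 := hu i
  -- With this value the mixed terms `v_i v_j` of the two new squares cancel.
  set κ : K := z * e ^ 2 / (x * c ^ 2) with hκ
  have hκ1 : x * c ^ 2 * κ = z * e ^ 2 := by rw [hκ]; field_simp
  have hκ2 : c ^ 2 * (1 + κ) = 1 := by
    apply mul_left_cancel₀ hx0
    linear_combination hκ1 + hx
  have hκ3 : y * d ^ 2 = y - z * e ^ 2 * (1 + κ) := by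
    apply mul_right_cancel₀ (pow_ne_zero 2 hc)
    linear_combination hy + z * e ^ 2 * hκ2
  have hi₀i : i₀ ≠ i := fun h => hi₀ (by simp [h])
  have hi₀j : i₀ ≠ j := fun h => hi₀ (by simp [h])
  have hi₀T : i₀ ∉ T' := fun h => hi₀ (by simp [h])
  have hiT' : i ∉ T' := fun h => hiT (by simp [h])
  set v' : ι → Fin k → K := Function.update (Function.update (Function.update v
    i (c • (v i - κ • v j))) j (d • v j)) i₀ (e • (v i + v j)) with hv'
  have e0 : v' i₀ = e • (v i + v j) := by simp [hv']
  have ei : v' i = c • (v i - κ • v j) := by simp [hv', hi₀i.symm, hij]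
  have ej : v' j = d • v j := by simp [hv', hi₀j.symm]
  have eT : ∀ l ∈ T', v' l = v l := fun l hl => by
    have h1 : l ≠ i₀ := fun h => hi₀T (h ▸ hl)
    have h2 : l ≠ i := fun h => hiT' (h ▸ hl)
    have h3 : l ≠ j := fun h => hjT (h ▸ hl)
    simp [hv', h1, h2, h3]
  have hsum : ∀ (t : ι → K) a b, ∑ l ∈ insert i₀ (insert i (insert j T')), t l * (v' l a * v' l b) =
      (∑ l ∈ T', t l * (v l a * v l b) + (t i * c ^ 2 + t i₀ * e ^ 2) * (v i a * v i b) +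
        (t i * c ^ 2 * κ ^ 2 + t j * d ^ 2 + t i₀ * e ^ 2) * (v j a * v j b)) +
        (t i₀ * e ^ 2 - t i * c ^ 2 * κ) * symProd (v i) (v j) a b := by
    intro t a b
    rw [Finset.sum_insert hi₀, Finset.sum_insert hiT, Finset.sum_insert hjT, e0, ei, ej,
      Finset.sum_congr rfl fun l hl => by rw [eT l hl]]
    simp only [Pi.smul_apply, Pi.add_apply, Pi.sub_apply, smul_eq_mul, symProd, Matrix.add_apply,
      Matrix.vecMulVec_apply]
    ring
  have hold : ∀ (t : ι → K) a b, ∑ l ∈ insert i (insert j T'), t l * (v l a * v l b) =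
      ∑ l ∈ T', t l * (v l a * v l b) + t i * (v i a * v i b) + t j * (v j a * v j b) := by
    intro t a b
    rw [Finset.sum_insert hiT, Finset.sum_insert hjT]
    ring
  refine ⟨v', ⟨fun a b => ?_, fun t ht => ?_, ?_⟩⟩
  · have hr := h.relation a b
    rw [hold] at hr
    rw [hsum]
    linear_combination hr + (v i a * v i b) * hx + (v j a * v j b) * (κ * hκ1 + hκ3) -
      symProd (v i) (v j) a b * hκ1
  · set s : K := t i₀ * e ^ 2 - t i * c ^ 2 * κ with hs
    set t' : ι → K := Function.update (Function.update t i (t i * c ^ 2 + t i₀ * e ^ 2)) j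
      (t i * c ^ 2 * κ ^ 2 + t j * d ^ 2 + t i₀ * e ^ 2) with ht'
    have ti : t' i = t i * c ^ 2 + t i₀ * e ^ 2 := by simp [ht', hij]
    have tj : t' j = t i * c ^ 2 * κ ^ 2 + t j * d ^ 2 + t i₀ * e ^ 2 := by simp [ht']
    have tT : ∀ l ∈ T', t' l = t l := fun l hl => by
      have h2 : l ≠ i := fun h => hiT' (h ▸ hl)
      have h3 : l ≠ j := fun h => hjT (h ▸ hl)
      simp [ht', h2, h3]
    have hnew : ∀ a b, ∑ l ∈ insert i (insert j T'), t' l * (v l a * v l b) =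
        -(s * symProd (v i) (v j) a b) := by
      intro a b
      have h1 := ht a b
      rw [hsum] at h1
      rw [hold, ti, tj, Finset.sum_congr rfl fun l hl => by rw [tT l hl]]
      linear_combination h1
    have hs0 : s = 0 := by
      by_contra hs0
      refine hnot (fun l => -(t' l / s)) ?_
      ext a b
      rw [Matrix.sum_apply]
      simp only [Matrix.smul_apply, Matrix.vecMulVec_apply, smul_eq_mul]
      have := hnew a b
      apply mul_left_cancel₀ hs0
      rw [Finset.mul_sum, ← neg_inj, ← this, ← Finset.sum_neg_distrib]
      refine Finset.sum_congr rfl fun l _ => ?_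
      field_simp
    obtain ⟨r, hr⟩ := h.unique t' fun a b => by rw [hnew, hs0, zero_mul, neg_zero]
    have hri := hr i hi
    have hrj := hr j hj
    change t' i = r * x at hri
    change t' j = r * y at hrj
    rw [ti] at hri
    rw [tj] at hrj
    have r1 : t i = r * x := by
      linear_combination hri - hs0 - t i * hκ2
    have r0 : t i₀ = r * z := by
      apply mul_right_cancel₀ (pow_ne_zero 2 he)
      linear_combination hs0 + c ^ 2 * κ * r1 + r * hκ1
    have rj : t j = r * y := by
      apply mul_right_cancel₀ (pow_ne_zero 2 hd)
      linear_combination hrj - r * hκ3 - c ^ 2 * κ ^ 2 * r1 - e ^ 2 * r0 - r * κ * hκ1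
    refine ⟨r, fun l hl => ?_⟩
    rw [Finset.mem_insert] at hl
    rcases hl with rfl | hl
    · exact r0
    by_cases hli : l = i
    · rw [hli]; exact r1
    by_cases hlj : l = j
    · rw [hlj]; exact rj
    rw [← hr l hl]
    simp [ht', hli, hlj]
  · rw [eq_top_iff, ← h.span_eq, Submodule.span_le]
    set S := Submodule.span K (v' '' (insert i₀ (insert i (insert j T')) : Finset ι)) with hS
    have hmem : ∀ l ∈ insert i₀ (insert i (insert j T')), v' l ∈ S := fun l hl =>
      Submodule.subset_span ⟨l, hl, rfl⟩
    have hvj : v j ∈ S := by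
      have := S.smul_mem d⁻¹ (hmem j (by simp))
      rwa [ej, inv_smul_smul₀ hd] at this
    have hvi : v i ∈ S := by
      have := S.add_mem (S.smul_mem c⁻¹ (hmem i (by simp))) (S.smul_mem κ hvj)
      rwa [ei, inv_smul_smul₀ hc, sub_add_cancel] at this
    rintro _ ⟨l, hl, rfl⟩
    rw [Finset.mem_coe, Finset.mem_insert, Finset.mem_insert] at hl
    rcases hl with rfl | rfl | hl
    · exact hvi
    · exact hvj
    · change v l ∈ S
      rw [← eT l hl]
      exact hmem l (by simp [hl])

theorem exists_isSelfDualConfiguration_univ [Infinite K] [Fintype ι] (h2 : (2 : K) ≠ 0)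
    (hk : 0 < k)
    (hsq : ∀ x y z : K, x ≠ 0 → y ≠ 0 → z ≠ 0 → ∃ c d e : K, c ≠ 0 ∧ d ≠ 0 ∧ e ≠ 0 ∧
      x * c ^ 2 = x - z * e ^ 2 ∧ y * d ^ 2 * c ^ 2 = y * c ^ 2 - z * e ^ 2)
    {u : ι → K} (hu : ∀ i, u i ≠ 0) (α β : Fin k ↪ ι) (hαβ : ∀ a b, α a ≠ β b)
    (huα : ∀ a, IsSquare (u (α a))) (huβ : ∀ a, IsSquare (-u (β a)))
    (hcard : Fintype.card ι ≤ (k + 1).choose 2 + 1) :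
    ∃ v : ι → Fin k → K, IsSelfDualConfiguration u Finset.univ v := by
  choose c hc using huα
  choose d hd using huβ
  have hc0 : ∀ a, c a ≠ 0 := fun a h => hu (α a) (by rw [hc, h, zero_mul])
  have hd0 : ∀ a, d a ≠ 0 := fun a h => hu (β a) (by
    rw [← neg_eq_zero, hd, h, zero_mul])
  have key : ∀ E : Finset ι, ∃ v : ι → Fin k → K,
      IsSelfDualConfiguration u (E ∪ (Finset.univ.map α ∪ Finset.univ.map β)) v := by
    intro E
    induction E using Finset.induction_on with
    | empty =>
      rw [Finset.empty_union]
      exact exists_isSelfDualConfiguration_base h2 hk α β hαβ hc0 hd0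
        (fun a => by rw [hc, sq]) fun a => by rw [sq, ← hd, neg_neg]
    | insert i E hi ih =>
      obtain ⟨v, hv⟩ := ih
      rw [Finset.insert_union]
      set T := E ∪ (Finset.univ.map α ∪ Finset.univ.map β)
      by_cases hiT : i ∈ T
      · rw [Finset.insert_eq_self.2 hiT]
        exact ⟨v, hv⟩
      · refine exists_isSelfDualConfiguration_insert h2 hk hsq hu hv ?_ hiT
        -- The upper bound on the number of vectors enters here: while `i` is missing, `T` has at
        -- most `(k + 1).choose 2` elements.
        have := (insert i T).card_le_univ
        rw [Finset.card_insert_of_notMem hiT] at this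
        omega
  obtain ⟨v, hv⟩ := key Finset.univ
  rw [Finset.union_eq_left.2 (Finset.subset_univ _)] at hv
  exact ⟨v, hv⟩

/-- Every form `u` with sufficiently many coefficients of both signs has an isotropic subspace
which is isotropic for no other diagonal form. -/
theorem exists_matrix_isUniqueForm [Infinite K] {n : ℕ} (h2 : (2 : K) ≠ 0) (hk : 0 < k)
    (hn : n ≤ (k + 1).choose 2 + 1)
    (hsq : ∀ x y z : K, x ≠ 0 → y ≠ 0 → z ≠ 0 → ∃ c d e : K, c ≠ 0 ∧ d ≠ 0 ∧ e ≠ 0 ∧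
      x * c ^ 2 = x - z * e ^ 2 ∧ y * d ^ 2 * c ^ 2 = y * c ^ 2 - z * e ^ 2)
    {u : Fin n → K} (hu : ∀ i, u i ≠ 0) (α β : Fin k ↪ Fin n) (hαβ : ∀ a b, α a ≠ β b)
    (huα : ∀ a, IsSquare (u (α a))) (huβ : ∀ a, IsSquare (-u (β a))) :
    ∃ X : Matrix (Fin k) (Fin n) K, IsUniqueForm u (rowSpan X) ∧
      ∃ I : Fin k ↪o Fin n, minor X I ≠ 0 := by
  obtain ⟨v, hv⟩ := exists_isSelfDualConfiguration_univ h2 hk hsq hu α β hαβ huα huβ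
    (by rwa [Fintype.card_fin])
  have hiff : ∀ x : Fin n → K, Isotropic x (rowSpan (Matrix.of v).transpose) ↔
      ∀ a b, ∑ i, x i * (v i a * v i b) = 0 := by
    intro x
    rw [isotropic_rowSpan_iff]
    simp only [Matrix.transpose_apply, Matrix.of_apply, mul_assoc]
  refine ⟨(Matrix.of v).transpose, ⟨(hiff u).2 hv.relation, fun y hy => ?_⟩, ?_⟩
  · obtain ⟨c, hc⟩ := hv.unique y ((hiff y).1 hy)
    exact ⟨c, funext fun i => hc i (Finset.mem_univ i)⟩
  · apply exists_minor_ne_zero_of_span_col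
    have := hv.span_eq
    rwa [Finset.coe_univ, Set.image_univ] at this

end Configuration


section Affine

variable {K : Type*} [Field K] {Y Z : Type*}

/-! ### Finite maps -/

theorem restrict_mem_basicOpenRing {A : Subalgebra K (Z → K)} {g a : Z → K} (ha : a ∈ A) :
    (fun z : basicOpen g => a z.1) ∈ basicOpenRing A g :=
  (le_sup_left : _ ≤ basicOpenRing A g) (Subalgebra.mem_map.2 ⟨a, ha, rfl⟩)

theorem inv_mem_basicOpenRing (A : Subalgebra K (Z → K)) (g : Z → K) :
    (fun z : basicOpen g => (g z.1)⁻¹) ∈ basicOpenRing A g :=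
  (le_sup_right : _ ≤ basicOpenRing A g) (Algebra.subset_adjoin rfl)

theorem pullback_mem_basicOpenRing {A : Subalgebra K (Y → K)} {B : Subalgebra K (Z → K)}
    {φ : Y → Z} (hφ : ∀ b ∈ B, pullback φ b ∈ A) {g : Y → K} {h : Z → K}
    (hgh : ∀ y, h (φ y) = g y) (hm : Set.MapsTo φ (basicOpen g) (basicOpen h))
    {b : basicOpen h → K} (hb : b ∈ basicOpenRing B h) :
    pullback (hm.restrict φ _ _) b ∈ basicOpenRing A g := by
  suffices basicOpenRing B h ≤ (basicOpenRing A g).comap (pullback (hm.restrict φ _ _)) from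
    this hb
  refine sup_le ?_ (Algebra.adjoin_le ?_)
  · rintro _ ⟨b, hb, rfl⟩
    exact restrict_mem_basicOpenRing (hφ b hb)
  · rintro _ rfl
    have := inv_mem_basicOpenRing A g
    simp only [← hgh] at this
    exact this

theorem basicOpenRing_map_adjoin {W : Type*} (S : Set (W → K)) (f : Y → W) (g : Y → K) :
    basicOpenRing ((Algebra.adjoin K S).map (pullback f)) g =
      Algebra.adjoin K (((pullback (Subtype.val : basicOpen g → Y)) '' (pullback f '' S)) ∪
        {fun z => (g z.1)⁻¹}) := by
  rw [basicOpenRing, restrictRing, AlgHom.map_adjoin, AlgHom.map_adjoin, ← Algebra.adjoin_union]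

/-- A morphism is finite if suitable powers of finitely many generators of the coordinate ring of
the source are pulled back from the target. -/
theorem isFiniteMap_of_pow {A : Subalgebra K (Y → K)} {B : Subalgebra K (Z → K)} {φ : Y → Z}
    (hφ : ∀ b ∈ B, pullback φ b ∈ A) {S : Set (Y → K)} (hS : S.Finite)
    (hA : A = Algebra.adjoin K S) {d : ℕ} (hd : d ≠ 0)
    (hpow : ∀ s ∈ S, ∃ b ∈ B, s ^ d = pullback φ b) : IsFiniteMap A B φ := by
  refine ⟨hφ, ?_⟩
  set ψ : B →ₐ[K] A := ((pullback φ).comp B.val).codRestrict A (fun b => hφ b b.2) with hψ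
  have hint : ψ.toRingHom.IsIntegral := by
    rintro ⟨a, ha⟩
    have ha' : a ∈ Algebra.adjoin K S := hA ▸ ha
    induction ha' using Algebra.adjoin_induction with
    | mem s hs =>
      obtain ⟨b, hb, hsb⟩ := hpow s hs
      refine ⟨Polynomial.X ^ d - Polynomial.C ⟨b, hb⟩, Polynomial.monic_X_pow_sub_C _ hd, ?_⟩
      rw [Polynomial.eval₂_sub, Polynomial.eval₂_pow, Polynomial.eval₂_X, Polynomial.eval₂_C,
        sub_eq_zero]
      exact Subtype.ext hsb
    | algebraMap r =>
      have : (⟨algebraMap K (Y → K) r, ha⟩ : A) = ψ.toRingHom (algebraMap K B r) :=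
        (ψ.commutes r).symm
      rw [this]
      exact ψ.toRingHom.isIntegralElem_map
    | add x y hx hy hx' hy' =>
      exact (hx' (hA ▸ hx)).add ψ.toRingHom (hy' (hA ▸ hy))
    | mul x y hx hy hx' hy' =>
      exact (hx' (hA ▸ hx)).mul ψ.toRingHom (hy' (hA ▸ hy))
  have hft : Algebra.FiniteType K A := by
    rw [← Subalgebra.fg_iff_finiteType, hA]
    exact ⟨hS.toFinset, by rw [hS.coe_toFinset]⟩
  have hft' : ψ.toRingHom.FiniteType := by
    have : (ψ.comp (Algebra.ofId K B)).FiniteType := by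
      have h1 : ψ.comp (Algebra.ofId K B) = Algebra.ofId K A := Subsingleton.elim _ _
      rw [h1]
      exact (RingHom.finiteType_algebraMap (A := K) (B := A)).2 hft
    exact AlgHom.FiniteType.of_comp_finiteType this
  exact hint.to_finite hft'

end Affine

section Discriminant

variable {K : Type*} [Field K] {k n : ℕ} (ν : Normalization K k n)

/-! ### The open set on which the diagonal form is unique -/

/-- The coefficients of a diagonal form obtained from `n - 1` of the linear conditions on it. -/
def formCoeff (q : (Fin n → Fin k × Fin k) × Fin n) (i : Fin n) (V : GrOpen K k n) : K :=
  (condMatrix (ν.mat V) q.1).adjugate i q.2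

/-- A linear combination of the products of the coefficients of the forms `formCoeff`. -/
def discriminant (c : (Fin n → Fin k × Fin k) × Fin n → K) (V : GrOpen K k n) : K :=
  ∑ q, c q * ∏ i, formCoeff ν q i V

/-- The numerator of the ratio of two coefficients of the form. -/
def ratioNum (c : (Fin n → Fin k × Fin k) × Fin n → K) (i j : Fin n) (V : GrOpen K k n) : K :=
  ∑ q, c q * (formCoeff ν q i V * ∏ l ∈ Finset.univ.erase j, formCoeff ν q l V)

variable {ν} {c : (Fin n → Fin k × Fin k) × Fin n → K}

theorem formCoeff_mem (q : (Fin n → Fin k × Fin k) × Fin n) (i : Fin n) :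
    formCoeff ν q i ∈ grRing K k n :=
  adjugate_mem _ _ (fun _ _ => mul_mem (ν.mat_mem _ _) (ν.mat_mem _ _)) _ _

theorem discriminant_mem : discriminant ν c ∈ grRing K k n := by
  have := (grRing K k n).sum_mem (t := Finset.univ)
    (f := fun q => c q • ∏ i, formCoeff ν q i) fun q _ =>
      (grRing K k n).smul_mem ((grRing K k n).prod_mem fun i _ => formCoeff_mem q i) _
  convert this using 1
  funext V
  simp [discriminant, Finset.sum_apply, Finset.prod_apply]

theorem ratioNum_mem (i j : Fin n) : ratioNum ν c i j ∈ grRing K k n := by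
  have := (grRing K k n).sum_mem (t := Finset.univ)
    (f := fun q => c q • (formCoeff ν q i * ∏ l ∈ Finset.univ.erase j, formCoeff ν q l))
      fun q _ => (grRing K k n).smul_mem (mul_mem (formCoeff_mem q i)
        ((grRing K k n).prod_mem fun i _ => formCoeff_mem q i)) _
  convert this using 1
  funext V
  simp [ratioNum, Finset.sum_apply, Finset.prod_apply]

theorem discriminant_eq_of_toX_eq {V W : GrOpen K k n} (h : toX V = toX W) :
    discriminant ν c V = discriminant ν c W := by
  simp only [discriminant, formCoeff, ν.mat_eq V W h]

theorem ratioNum_eq_of_toX_eq (i j : Fin n) {V W : GrOpen K k n} (h : toX V = toX W) :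
    ratioNum ν c i j V = ratioNum ν c i j W := by
  simp only [ratioNum, formCoeff, ν.mat_eq V W h]

/-- Where the discriminant is nonzero and `x j ≠ 0`, the quotient `ratioNum / discriminant` is thus
`x i / x j`, a regular torus-invariant expression for the ratio of coefficients. -/
theorem mul_ratioNum {V : GrOpen K k n} {x : Fin n → K}
    (hx : Isotropic x (rowSpan (ν.mat V))) (i j : Fin n) :
    x j * ratioNum ν c i j V = x i * discriminant ν c V := by
  rw [ratioNum, discriminant, Finset.mul_sum, Finset.mul_sum]
  refine Finset.sum_congr rfl fun q _ => ?_
  rw [← Finset.mul_prod_erase _ _ (Finset.mem_univ j)]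
  have := mul_adjugate_comm (condMatrix_mulVec hx q.1) i j q.2
  change x j * formCoeff ν q i V = x i * formCoeff ν q j V at this
  linear_combination (c q * ∏ l ∈ Finset.univ.erase j, formCoeff ν q l V) * this

theorem exists_forall_formCoeff_ne_zero {V : GrOpen K k n} (h : discriminant ν c V ≠ 0) :
    ∃ q, ∀ i, formCoeff ν q i V ≠ 0 := by
  obtain ⟨q, -, hq⟩ := Finset.exists_ne_zero_of_sum_ne_zero h
  exact ⟨q, fun i => Finset.prod_ne_zero_iff.1 (right_ne_zero_of_mul hq) i (Finset.mem_univ i)⟩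

/-- Points of the closure need not be self-projecting a priori. But isotropy for the cofactor form
is a closed condition that holds on self-projecting subspaces, so it extends to `SGr`. -/
theorem isotropic_formCoeff {V : GrOpen K k n} (hV : V.1 ∈ SGr K k n) (hn : 0 < n)
    (q : (Fin n → Fin k × Fin k) × Fin n) :
    Isotropic (fun i => formCoeff ν q i V) (rowSpan (ν.mat V)) := by
  rw [isotropic_rowSpan_iff]
  intro a b
  have hmem : (fun V => ∑ i, formCoeff ν q i V * ν.mat V a i * ν.mat V b i) ∈ grRing K k n := by
    have := (grRing K k n).sum_mem (t := Finset.univ)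
      (f := fun i V => formCoeff ν q i V * ν.mat V a i * ν.mat V b i) fun i _ =>
        mul_mem (mul_mem (formCoeff_mem q i) (ν.mat_mem a i)) (ν.mat_mem b i)
    convert this using 1
    funext V
    simp
  refine eq_zero_of_mem_zariskiClosure hmem (S := selfProjecting K k n) ?_ V hV
  rintro W ⟨l, hl⟩
  rw [mem_OGr_iff, ν.isotropic_mat] at hl
  have hne : (fun i => (l i : K) * (ν.scale W i : K) ^ 2) ≠ 0 := fun h0 =>
    mul_ne_zero (l ⟨0, hn⟩).ne_zero (pow_ne_zero 2 (ν.scale W ⟨0, hn⟩).ne_zero)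
      (congrFun h0 ⟨0, hn⟩)
  rw [← sum_adjugate_condMatrix hne hl q.1 q.2 a b]
  refine Finset.sum_congr rfl fun i _ => ?_
  rw [formCoeff]
  ring

/-- On the open set where the discriminant does not vanish, the points of `SGr(k,n)°` are
self-projecting for an essentially unique form. -/
theorem exists_isUniqueForm_of_discriminant_ne_zero {V : GrOpen K k n} (hV : V.1 ∈ SGr K k n)
    (hn : 0 < n) (h : discriminant ν c V ≠ 0) :
    ∃ l : Fin n → Kˣ, IsUniqueForm (fun i => (l i : K)) (rowSpan (ν.mat V)) := by
  obtain ⟨q, hq⟩ := exists_forall_formCoeff_ne_zero h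
  exact ⟨fun i => Units.mk0 _ (hq i), isUniqueForm_of_adjugate_ne_zero (isotropic_formCoeff hV hn q)
    (hq ⟨0, hn⟩) (hq ⟨0, hn⟩)⟩

/-- For each relevant `u`, some point has a nonzero vector of products of cofactors, indexed by `q`.
Over an infinite field one linear functional is nonzero on these finitely many vectors; its
coefficients are `c`, so a single function serves all components. -/
theorem exists_discriminant_ne_zero [Infinite K] (hk : 0 < k) (hn : 0 < n)
    (ν : Normalization K k n) {L : Set (Fin n → Kˣ)} (hL : L.Finite)
    (hgood : ∀ u ∈ L, (∃ V : GrOpen K k n, V.1 ∈ OGr u) →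
      ∃ V : GrOpen K k n, IsUniqueForm (fun i => (u i : K)) V.1.1) :
    ∃ c : (Fin n → Fin k × Fin k) × Fin n → K, ∀ u ∈ L,
      (∃ V : GrOpen K k n, V.1 ∈ OGr u) →
      ∃ V : GrOpen K k n, V.1 ∈ OGr u ∧ discriminant ν c V ≠ 0 := by
  set L' := {u ∈ L | ∃ V : GrOpen K k n, V.1 ∈ OGr u} with hL'
  have hfin : Finite L' := (hL.subset fun u hu => hu.1).to_subtype
  choose V hV using fun u : L' => hgood u.1 u.2.1 u.2.2
  have hex : ∀ u : L', ∃ q, ∀ i, formCoeff ν q i (V u) ≠ 0 := by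
    intro u
    have hu := hV u
    rw [ν.eq_map, isUniqueForm_map_torusScale] at hu
    obtain ⟨R, r, hR⟩ := exists_adjugate_ne_zero hk
      (fun i => mul_ne_zero (u.1 i).ne_zero (pow_ne_zero 2 (Units.ne_zero _))) hn hu
    exact ⟨(R, r), hR⟩
  obtain ⟨f, hf⟩ := Module.exists_dual_forall_apply_ne_zero (K := K)
    (fun (u : L') (q : (Fin n → Fin k × Fin k) × Fin n) => ∏ i, formCoeff ν q i (V u))
    fun u h0 => by
      obtain ⟨q, hq⟩ := hex u
      exact Finset.prod_ne_zero_iff.2 (fun i _ => hq i) (congrFun h0 q)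
  classical
  refine ⟨fun q => f (Pi.single q 1), fun u hu hne => ⟨V ⟨u, hu, hne⟩, (hV ⟨u, hu, hne⟩).1, ?_⟩⟩
  convert hf ⟨u, hu, hne⟩ using 1
  rw [f.pi_apply_eq_sum_univ, discriminant]
  refine Finset.sum_congr rfl fun q _ => ?_
  rw [smul_eq_mul, mul_comm]
  congr 2
  funext j
  simp [Pi.single_apply, eq_comm]

end Discriminant


/-! ### Degree, finiteness and density over a general field -/

section MainResult

variable {K : Type*} [Field K] {k n : ℕ}

/-- A finite set of sign vectors representing all nonzero diagonal forms uniquely, up to scaling the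
form and rescaling the coordinates. -/
structure IsSignSystem (L : Set (Fin n → Kˣ)) : Prop where
  finite : L.Finite
  sq_eq_one : ∀ u ∈ L, ∀ i, (u i : K) ^ 2 = 1
  exists_eq : ∀ l : Fin n → Kˣ, ∃ u ∈ L, ∃ (c : Kˣ) (t : Fin n → Kˣ), ∀ i, l i = c * u i * t i ^ 2
  unique : ∀ u ∈ L, ∀ u' ∈ L, ∀ (c : Kˣ) (t : Fin n → Kˣ), (∀ i, u' i = c * u i * t i ^ 2) → u' = u

theorem isotropic_smul_iff {c : K} (hc : c ≠ 0) {x : Fin n → K} {V : Submodule K (Fin n → K)} :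
    Isotropic (fun i => c * x i) V ↔ Isotropic x V := by
  simp only [Isotropic, mul_assoc, ← Finset.mul_sum, mul_eq_zero, hc, false_or]

theorem ncard_signs (h2 : (2 : K) ≠ 0) {t : Fin n → K} (ht : ∀ i, t i ≠ 0) (j : Fin n) :
    {s : Fin n → K | s j = t j ∧ ∀ i, s i = t i ∨ s i = -t i}.ncard = 2 ^ (n - 1) := by
  classical
  have hne : ∀ i, t i ≠ -t i := fun i h => by
    have : 2 * t i = 0 := by linear_combination h
    exact mul_ne_zero h2 (ht i) this
  have : {s : Fin n → K | s j = t j ∧ ∀ i, s i = t i ∨ s i = -t i} =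
      Fintype.piFinset fun i => if i = j then {t i} else {t i, -t i} := by
    ext s
    simp only [Set.mem_ofPred_eq, Finset.mem_coe, Fintype.mem_piFinset]
    constructor
    · rintro ⟨h1, h2⟩ i
      split_ifs with hi
      · subst hi
        simpa using h1
      · simpa using h2 i
    · intro h
      refine ⟨by simpa using h j, fun i => ?_⟩
      have := h i
      split_ifs at this with hi
      · exact Or.inl (by simpa using this)
      · simpa using this
  rw [this, Set.ncard_coe_finset, Fintype.card_piFinset,
    ← Finset.mul_prod_erase _ _ (Finset.mem_univ j), if_pos rfl, Finset.card_singleton, one_mul]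
  rw [Finset.prod_congr rfl fun i hi => by
    rw [if_neg (Finset.ne_of_mem_erase hi), Finset.card_pair (hne i)]]
  rw [Finset.prod_const, Finset.card_erase_of_mem (Finset.mem_univ j), Finset.card_univ,
    Fintype.card_fin]

/-- The scaling factors identify the isotropic points in the orbit of a point with nonzero
discriminant with the choices of signs of the coordinates, up to a common sign. -/
theorem exists_image_scale_eq (ν : Normalization K k n) (hkn : k ≤ n) {L : Set (Fin n → Kˣ)}
    (hL : IsSignSystem L) {V₀ : GrOpen K k n} {l : Fin n → Kˣ}
    (hl : IsUniqueForm (fun i => (l i : K)) (rowSpan (ν.mat V₀))) :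
    ∃ t : Fin n → Kˣ, (fun (V : GrOpen K k n) i => (ν.scale V i : K)) ''
      {V | V ∈ ogrOpen k L ∧ toX V = toX V₀} =
      {s | s ν.base = (t ν.base : K) ∧ ∀ i, s i = (t i : K) ∨ s i = -(t i : K)} := by
  obtain ⟨u, hu, c, t, ht⟩ := hL.exists_eq l
  have ht' : ∀ i, (l i : K) = c * u i * (t i : K) ^ 2 := fun i => by rw [ht]; simp
  refine ⟨fun i => t i / t ν.base, ?_⟩
  simp only [div_self', Units.val_one]
  ext s
  constructor
  · rintro ⟨V, ⟨⟨u', hu', hV⟩, hVX⟩, rfl⟩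
    rw [mem_OGr_iff, ν.isotropic_mat, ν.mat_eq V V₀ hVX] at hV
    obtain ⟨e, he⟩ := hl.2 _ hV
    have he' : ∀ i, (u' i : K) * (ν.scale V i : K) ^ 2 = e * (c * u i * (t i : K) ^ 2) := fun i => by
      rw [← ht']
      exact congrFun he i
    have he0 : e ≠ 0 := by
      rintro rfl
      have := he' ν.base
      rw [zero_mul] at this
      exact mul_ne_zero (Units.ne_zero _) (pow_ne_zero 2 (Units.ne_zero _)) this
    -- By uniqueness of the form, all isotropic points of one orbit belong to the same
    -- representative.
    have huu : u' = u := by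
      refine hL.unique u hu u' hu' (Units.mk0 e he0 * c) (fun i => t i / ν.scale V i) fun i => ?_
      ext
      have h1 := he' i
      have h2 : (ν.scale V i : K) ≠ 0 := Units.ne_zero _
      simp only [Units.val_mul, Units.val_mk0, Units.val_pow_eq_pow_val, Units.val_div_eq_div_val]
      field_simp
      linear_combination h1
    subst huu
    have hb := he' ν.base
    rw [ν.scale_base, Units.val_one, one_pow, mul_one] at hb
    refine ⟨by simp [ν.scale_base], fun i => ?_⟩
    rw [← sq_eq_sq_iff_eq_or_eq_neg]
    have h1 : ((u' i : Kˣ) : K) ≠ 0 := Units.ne_zero _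
    have h2 : (t ν.base : K) ≠ 0 := Units.ne_zero _
    have h3 : ((u' ν.base : Kˣ) : K) ≠ 0 := Units.ne_zero _
    have hec : e * c * (t ν.base : K) ^ 2 = 1 := by
      apply mul_left_cancel₀ h3
      linear_combination -hb
    simp only [Units.val_div_eq_div_val]
    apply mul_left_cancel₀ h1
    rw [he' i, div_pow]
    field_simp
    linear_combination hec
  · rintro ⟨hs1, hs⟩
    have hs0 : ∀ i, s i ≠ 0 := by
      intro i
      rcases hs i with h | h <;> rw [h]
      · exact Units.ne_zero _
      · exact neg_ne_zero.2 (Units.ne_zero _)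
    obtain ⟨W, hW⟩ := exists_torusScale hkn V₀ fun i => Units.mk0 (s i) (hs0 i) / ν.scale V₀ i
    have hWX : toX W = toX V₀ := (toX_eq_iff.2 ⟨_, hW⟩).symm
    have hWs : ∀ i, (ν.scale W i : K) = s i := by
      intro i
      rw [ν.scale_map V₀ W _ hW, ν.scale_base]
      simp [hs1]
    refine ⟨W, ⟨⟨u, hu, ?_⟩, hWX⟩, funext hWs⟩
    rw [mem_OGr_iff, ν.isotropic_mat, ν.mat_eq W V₀ hWX]
    simp only [hWs]
    have hc : (c : K) * (t ν.base : K) ^ 2 ≠ 0 :=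
      mul_ne_zero (Units.ne_zero _) (pow_ne_zero 2 (Units.ne_zero _))
    rw [← isotropic_smul_iff hc]
    convert hl.1 using 2 with i
    rw [ht']
    have : s i ^ 2 = ((t i / t ν.base : Kˣ) : K) ^ 2 := by
      rw [sq_eq_sq_iff_eq_or_eq_neg]
      exact hs i
    rw [this, Units.val_div_eq_div_val]
    have h2 : (t ν.base : K) ≠ 0 := Units.ne_zero _
    field_simp

theorem pullback_ogrToXsd_mem (L : Set (Fin n → Kˣ)) {b : Xsd K k n → K} (hb : b ∈ xsdRing K k n) :
    pullback (ogrToXsd k L) b ∈ ogrRing k L := by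
  obtain ⟨F, hF, rfl⟩ := hb
  exact ⟨pullback toX F, hF, rfl⟩

/-- The form on the normalized matrix has coefficients `u i * scale i ^ 2`, so `scale i ^ 2` is a
cofactor ratio up to the sign `u`. A second squaring removes the sign and gives one formula valid on
every component. -/
theorem scale_pow_four {ν : Normalization K k n} {c : (Fin n → Fin k × Fin k) × Fin n → K}
    {u : Fin n → Kˣ} (hu : ∀ i, (u i : K) ^ 2 = 1) {V : GrOpen K k n} (hV : V.1 ∈ OGr u)
    (hd : discriminant ν c V ≠ 0) (i : Fin n) :
    (ν.scale V i : K) ^ 4 = (ratioNum ν c i ν.base V / discriminant ν c V) ^ 2 ∧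
    (ν.scale V i : K)⁻¹ ^ 4 = (ratioNum ν c ν.base i V / discriminant ν c V) ^ 2 := by
  rw [mem_OGr_iff, ν.isotropic_mat] at hV
  have h1 := mul_ratioNum (c := c) hV i ν.base
  have h2 := mul_ratioNum (c := c) hV ν.base i
  simp only [ν.scale_base, Units.val_one, one_pow, mul_one] at h1 h2
  have hs : (ν.scale V i : K) ≠ 0 := Units.ne_zero _
  have hub := hu ν.base
  have hui := hu i
  set s := (ν.scale V i : K)
  set d := discriminant ν c V
  set p := ratioNum ν c i ν.base V
  set r := ratioNum ν c ν.base i V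
  constructor
  · have : p ^ 2 = s ^ 4 * d ^ 2 := by
      calc p ^ 2 = ((u ν.base : K) * p) ^ 2 := by rw [mul_pow, hub, one_mul]
        _ = (u i : K) ^ 2 * (s ^ 4 * d ^ 2) := by rw [h1]; ring
        _ = _ := by rw [hui, one_mul]
    field_simp
    linear_combination -this
  · have : s ^ 4 * r ^ 2 = d ^ 2 := by
      calc s ^ 4 * r ^ 2 = (u i : K) ^ 2 * (s ^ 4 * r ^ 2) := by rw [hui, one_mul]
        _ = ((u i : K) * s ^ 2 * r) ^ 2 := by ring
        _ = (u ν.base : K) ^ 2 * d ^ 2 := by rw [h2]; ring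
        _ = _ := by rw [hub, one_mul]
    field_simp
    linear_combination -this

theorem dominantFiniteOnOpens [Infinite K] (h2 : (2 : K) ≠ 0) (hk : 0 < k) (hkn : k < n)
    {L : Set (Fin n → Kˣ)} (hL : IsSignSystem L)
    (hne : (selfProjecting K k n ∩ {V | ∀ I, plucker V I ≠ 0}).Nonempty)
    (hgood : ∀ u ∈ L, (∃ V : GrOpen K k n, V.1 ∈ OGr u) →
      ∃ V : GrOpen K k n, IsUniqueForm (fun i => (u i : K)) V.1.1) :
    DominantFiniteOnOpens (ogrRing k L) (xsdRing K k n) (ogrToXsd k L) (2 ^ (n - 1)) := by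
  obtain ⟨ν⟩ := nonempty_normalization (K := K) hk hkn
  have hn : 0 < n := hk.trans hkn
  obtain ⟨c, hc⟩ := exists_discriminant_ne_zero hk hn ν hL.finite hgood
  obtain ⟨D, hD, hDV⟩ := exists_xRing_lift (discriminant_mem (ν := ν) (c := c))
    fun V W => discriminant_eq_of_toX_eq
  -- Density is checked separately for each `u`, along curves inside its isotropic locus.
  have hdense : ∀ a ∈ grRing K k n,
      (∀ V ∈ ogrOpen k L, discriminant ν c V ≠ 0 → a V = 0) → ∀ V ∈ ogrOpen k L, a V = 0 := by
    rintro a ha h V ⟨u, hu, hV⟩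
    obtain ⟨V₁, hV₁, hd⟩ := hc u hu ⟨V, hV⟩
    refine eq_zero_of_mul_eq_zero_of_isotropic h2 hkn.le u ha discriminant_mem
      (fun V W => discriminant_eq_of_toX_eq) (fun W hW => ?_) hV₁ hd V hV
    by_cases hdW : discriminant ν c W = 0
    · rw [hdW, mul_zero]
    · rw [h W ⟨u, hu, hW⟩ hdW, zero_mul]
  have hrep : ∀ V : GrOpen K k n, V.1 ∈ selfProjecting K k n →
      ∃ W ∈ ogrOpen k L, toX W = toX V := by
    rintro V ⟨l, hl⟩
    obtain ⟨u, hu, e, t, ht⟩ := hL.exists_eq l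
    obtain ⟨W, hW⟩ := exists_torusScale hkn.le V t
    refine ⟨W, ⟨u, hu, ?_⟩, (toX_eq_iff.2 ⟨t, hW⟩).symm⟩
    rw [mem_OGr_iff, hW, isotropic_map_torusScale, ← isotropic_smul_iff e.ne_zero]
    rw [mem_OGr_iff] at hl
    convert hl using 2 with i
    rw [ht i]
    simp [mul_assoc]
  set g : ogrOpen k L → K := fun V => discriminant ν c V.1 with hg
  set h : Xsd K k n → K := fun x => D x.1 with hh
  have hgh : ∀ V, h (ogrToXsd k L V) = g V := fun V => hDV V.1
  have hgA : g ∈ ogrRing k L := ⟨discriminant ν c, discriminant_mem, rfl⟩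
  have hhB : h ∈ xsdRing K k n := ⟨D, hD, rfl⟩
  have hm : Set.MapsTo (ogrToXsd k L) (basicOpen g) (basicOpen h) := fun V hV => by
    rw [Set.mem_ofPred_eq, hgh]
    exact hV
  have hnonempty : (basicOpen g).Nonempty := by
    obtain ⟨V, hV, hV0⟩ := hne
    obtain ⟨W, ⟨u, hu, hW⟩, -⟩ := hrep ⟨V, hV0⟩ hV
    obtain ⟨V₁, hV₁, hd⟩ := hc u hu ⟨W, hW⟩
    exact ⟨⟨V₁, u, hu, hV₁⟩, hd⟩
  have hfib : ∀ x : basicOpen h,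
      {v : basicOpen g | hm.restrict (ogrToXsd k L) _ _ v = x}.ncard = 2 ^ (n - 1) := by
    rintro ⟨⟨_, V₀, hV₀, rfl⟩, hx⟩
    have hd : discriminant ν c V₀ ≠ 0 := by rw [← hDV]; exact hx
    obtain ⟨l, hl⟩ := exists_isUniqueForm_of_discriminant_ne_zero hV₀ hn hd
    obtain ⟨t, ht⟩ := exists_image_scale_eq ν hkn.le hL hl
    rw [← ncard_signs h2 (fun i => (t i).ne_zero) ν.base, ← ht]
    have hiff : ∀ v : basicOpen g, hm.restrict (ogrToXsd k L) _ _ v =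
        ⟨⟨toX V₀, V₀, hV₀, rfl⟩, hx⟩ ↔ toX v.1.1 = toX V₀ := fun v => by
      rw [Subtype.ext_iff, Subtype.ext_iff]
      rfl
    rw [Set.InjOn.ncard_image, ← Set.ncard_image_of_injective _
      (Subtype.val_injective.comp Subtype.val_injective)]
    · congr 1
      ext V
      simp only [Set.mem_image, Set.mem_ofPred_eq, hiff, Function.comp_apply]
      constructor
      · rintro ⟨v, hv, rfl⟩
        exact ⟨v.1.2, hv⟩
      · rintro ⟨hV, hVX⟩
        refine ⟨⟨⟨V, hV⟩, ?_⟩, hVX, rfl⟩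
        change discriminant ν c V ≠ 0
        rwa [discriminant_eq_of_toX_eq hVX]
    -- Within an orbit the normalized matrix is constant, so the scaling factors determine the
    -- point.
    · rintro V ⟨-, hV⟩ W ⟨-, hW⟩ hVW
      apply grOpen_ext
      have hs : ν.scale V = ν.scale W := funext fun i => Units.ext (congrFun hVW i)
      rw [ν.eq_map V, ν.eq_map W, hs, ν.mat_eq V W (hV.trans hW.symm)]
  have hpow : ∀ i, ∃ b ∈ basicOpenRing (xsdRing K k n) h, ∃ b' ∈ basicOpenRing (xsdRing K k n) h,
      ∀ v : basicOpen g,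
        (ν.scale v.1.1 i : K) ^ 4 = b (hm.restrict (ogrToXsd k L) _ _ v) ∧
        (ν.scale v.1.1 i : K)⁻¹ ^ 4 = b' (hm.restrict (ogrToXsd k L) _ _ v) := by
    have hratio : ∀ i j, ∃ b ∈ basicOpenRing (xsdRing K k n) h, ∀ v : basicOpen g,
        (ratioNum ν c i j v.1.1 / discriminant ν c v.1.1) ^ 2 =
          b (hm.restrict (ogrToXsd k L) _ _ v) := by
      intro i j
      obtain ⟨F, hF, hFV⟩ := exists_xRing_lift (ratioNum_mem (ν := ν) (c := c) i j)
        fun V W => ratioNum_eq_of_toX_eq i j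
      have hFB : (fun x : Xsd K k n => F x.1) ∈ xsdRing K k n := ⟨F, hF, rfl⟩
      refine ⟨_, pow_mem (mul_mem (restrict_mem_basicOpenRing (g := h) hFB)
        (inv_mem_basicOpenRing _ h)) 2, fun v => ?_⟩
      rw [← hFV, ← hDV, div_eq_mul_inv]
      rfl
    intro i
    obtain ⟨b, hb, hbv⟩ := hratio i ν.base
    obtain ⟨b', hb', hbv'⟩ := hratio ν.base i
    refine ⟨b, hb, b', hb', fun v => ?_⟩
    rw [← hbv, ← hbv']
    obtain ⟨u, hu, hV⟩ := v.1.2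
    exact scale_pow_four (hL.sq_eq_one u hu) hV v.2 i
  refine ⟨g, hgA, h, hhB, ?_, ?_, hnonempty, hnonempty.image _ |>.mono hm.image_subset, hm, ?_, ?_,
    hfib⟩
  · rintro _ ⟨a, ha, rfl⟩ hz V
    exact hdense a ha (fun V hV hd => hz ⟨V, hV⟩ hd) V.1 V.2
  -- It suffices to test on self-projecting subspaces, since vanishing passes to the closure; each
  -- of these has a representative in `ogrOpen k L` in its orbit, where `hdense` applies.
  · rintro _ ⟨a, ha, rfl⟩ hz ⟨_, V, hV, rfl⟩
    refine eq_zero_of_mem_zariskiClosure (a := pullback toX a) ha (fun W hW => ?_) V hV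
    obtain ⟨W', hW', hWW⟩ := hrep W hW
    change a (toX W) = 0
    rw [← hWW]
    refine hdense (pullback toX a) ha (fun V hV hd => ?_) W' hW'
    refine hz (ogrToXsd k L ⟨V, hV⟩) ?_
    rw [Set.mem_ofPred_eq, hgh]
    exact hd
  -- The generators are the Plücker ratios and `1 / g`. A ratio is an invariant minor ratio times
  -- scaling factors and their inverses, whose fourth powers descend by `hpow`.
  · refine isFiniteMap_of_pow (d := 4) (fun b hb => pullback_mem_basicOpenRing
      (fun b hb => pullback_ogrToXsd_mem L hb) hgh hm hb) ?_ (basicOpenRing_map_adjoin _ _ _)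
      (by norm_num) ?_
    · exact (((Set.finite_range _).image _).image _).union (Set.finite_singleton _)
    · rintro _ (⟨_, ⟨_, ⟨⟨I, J⟩, rfl⟩, rfl⟩, rfl⟩ | rfl)
      · choose b hb b' hb' hbb using hpow
        obtain ⟨F, hF, hFV⟩ := exists_xRing_lift (ν.minor_div_mem I J)
          fun V W hVW => by rw [ν.mat_eq V W hVW]
        have hFB : (fun x : Xsd K k n => F x.1) ∈ xsdRing K k n := ⟨F, hF, rfl⟩
        refine ⟨_, mul_mem (pow_mem (restrict_mem_basicOpenRing (g := h) hFB) 4)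
          (mul_mem (Subalgebra.prod_mem _ fun a (_ : a ∈ Finset.univ) => hb (I a))
            (Subalgebra.prod_mem _ fun a (_ : a ∈ Finset.univ) => hb' (J a))), ?_⟩
        funext v
        change (plucker v.1.1.1 I / plucker v.1.1.1 J) ^ 4 = F (toX v.1.1) ^ 4 *
          ((∏ a, b (I a)) (hm.restrict (ogrToXsd k L) _ _ v) *
            (∏ a, b' (J a)) (hm.restrict (ogrToXsd k L) _ _ v))
        rw [ν.plucker_div, hFV, mul_pow, mul_pow, ← Finset.prod_pow, ← Finset.prod_pow,
          Finset.prod_apply, Finset.prod_apply]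
        simp only [(hbb _ v).1, (hbb _ v).2]
      · refine ⟨_, pow_mem (inv_mem_basicOpenRing _ h) 4, ?_⟩
        funext v
        change (g v.1)⁻¹ ^ 4 = (h (ogrToXsd k L v.1))⁻¹ ^ 4
        rw [hgh]
  -- The fibers have positive cardinality, so the map is even surjective.
  · intro b _ hb x
    have hx := hfib x
    have : {v : basicOpen g | hm.restrict (ogrToXsd k L) _ _ v = x}.Nonempty :=
      Set.nonempty_of_ncard_ne_zero (by rw [hx]; positivity)
    obtain ⟨v, rfl⟩ := this
    exact hb _ ⟨v, rfl⟩

end MainResult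


/-! ### Nonemptiness and subspaces with a unique form -/

section Existence

variable {K : Type*} [Field K] {k n : ℕ}

/-- The Vandermonde matrix provides a self-projecting subspace with nonzero Plücker coordinates. -/
theorem selfProjecting_inter_nonempty [Infinite K] (hk : 1 ≤ k) (hkn : 2 * k ≤ n) :
    (selfProjecting K k n ∩ {V | ∀ I, plucker V I ≠ 0}).Nonempty := by
  classical
  set a : Fin n → K := fun i => Infinite.natEmbedding K i with ha
  have hinj : Function.Injective a := (Infinite.natEmbedding K).injective.comp Fin.val_injective
  set X : Matrix (Fin k) (Fin n) K := Matrix.of fun p i => a i ^ (p : ℕ) with hX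
  have hminor : ∀ I : Fin k ↪o Fin n, minor X I ≠ 0 := by
    intro I
    have : X.submatrix id I = (Matrix.vandermonde (a ∘ I)).transpose := by
      ext p q
      simp [hX, Matrix.vandermonde_apply]
    rw [minor, this, Matrix.det_transpose, Matrix.det_vandermonde_ne_zero_iff]
    exact hinj.comp I.injective
  obtain ⟨V, hV⟩ := exists_grOpen (by omega) X hminor
  have hl : ∀ i, (∏ j ∈ Finset.univ.erase i, (a i - a j))⁻¹ ≠ 0 := fun i =>
    inv_ne_zero <| Finset.prod_ne_zero_iff.2 fun j hj =>
      sub_ne_zero.2 fun h => Finset.ne_of_mem_erase hj (hinj h).symm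
  refine ⟨V.1, ⟨fun i => Units.mk0 _ (hl i), ?_⟩, V.2⟩
  rw [mem_OGr_iff, hV, isotropic_rowSpan_iff]
  intro p q
  -- With weights `1 / ∏ (a i - a j)`, Lagrange interpolation identifies the sum of the `a i ^ (p +
  -- q)` with the coefficient of `X ^ (n - 1)` in `X ^ (p + q)`. It is zero because `p + q ≤ 2k - 2
  -- < n - 1`.
  have hcoeff := Lagrange.coeff_eq_sum (s := Finset.univ) (v := a) hinj.injOn
    (P := (Polynomial.X : Polynomial K) ^ (p + q : ℕ)) (by
      rw [Polynomial.degree_X_pow, Finset.card_univ, Fintype.card_fin]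
      exact_mod_cast (by omega : (p : ℕ) + q < n))
  rw [Polynomial.coeff_X_pow, Finset.card_univ, Fintype.card_fin, if_neg (by omega)] at hcoeff
  rw [hcoeff]
  refine Finset.sum_congr rfl fun i _ => ?_
  rw [Polynomial.eval_pow, Polynomial.eval_X]
  simp only [Units.val_mk0, hX, Matrix.of_apply, pow_add, div_eq_mul_inv]
  ring

/-- Criterion for the existence of isotropic subspaces determining their form. -/
theorem exists_isUniqueForm_of_isSquare [Infinite K] (h2 : (2 : K) ≠ 0) (hk : 0 < k) (hkn : k ≤ n)
    (hn : n ≤ (k + 1).choose 2 + 1)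
    (hsq : ∀ x y z : K, x ≠ 0 → y ≠ 0 → z ≠ 0 → ∃ c d e : K, c ≠ 0 ∧ d ≠ 0 ∧ e ≠ 0 ∧
      x * c ^ 2 = x - z * e ^ 2 ∧ y * d ^ 2 * c ^ 2 = y * c ^ 2 - z * e ^ 2)
    (u : Fin n → Kˣ) (α β : Fin k ↪ Fin n) (hαβ : ∀ a b, α a ≠ β b)
    (huα : ∀ a, IsSquare (u (α a) : K)) (huβ : ∀ a, IsSquare (-(u (β a) : K)))
    (h : ∃ V : GrOpen K k n, V.1 ∈ OGr u) :
    ∃ V : GrOpen K k n, IsUniqueForm (fun i => (u i : K)) V.1.1 := by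
  obtain ⟨V₀, h₀⟩ := h
  obtain ⟨X, hX, I, hI⟩ := exists_matrix_isUniqueForm h2 hk hn hsq (u := fun i => (u i : K))
    (fun i => (u i).ne_zero) α β hαβ huα huβ
  exact exists_isUniqueForm h2 hk hkn u V₀ h₀ X hX I hI

end Existence

/-! ### Algebraically closed fields -/

section AlgClosed

variable (K : Type*) [Field K] [IsAlgClosed K] {k n : ℕ}

theorem isSignSystem_one : IsSignSystem ({1} : Set (Fin n → Kˣ)) where
  finite := Set.finite_singleton _
  sq_eq_one := by
    rintro _ rfl i
    simp
  exists_eq l := by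
    choose t ht using fun i => IsAlgClosed.exists_pow_nat_eq (l i : K) two_pos
    have ht0 : ∀ i, t i ≠ 0 := fun i h => (l i).ne_zero (by rw [← ht, h, zero_pow two_ne_zero])
    refine ⟨1, rfl, 1, fun i => Units.mk0 (t i) (ht0 i), fun i => Units.ext ?_⟩
    simp [ht]
  unique := by
    rintro _ rfl _ rfl _ _ _
    rfl

/-- Choose `e` off the zeros of the polynomials expressing `c ^ 2` and `c ^ 2 * d ^ 2`, then extract
square roots. -/
theorem exists_diagonalization_of_isAlgClosed (x y z : K) (hx : x ≠ 0) (hy : y ≠ 0) (_ : z ≠ 0) :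
    ∃ c d e : K, c ≠ 0 ∧ d ≠ 0 ∧ e ≠ 0 ∧
      x * c ^ 2 = x - z * e ^ 2 ∧ y * d ^ 2 * c ^ 2 = y * c ^ 2 - z * e ^ 2 := by
  have : Infinite K := IsAlgClosed.instInfinite
  obtain ⟨e, he, h1, h2⟩ : ∃ e : K, e ≠ 0 ∧ 1 - z / x * e ^ 2 ≠ 0 ∧
      1 - (z / x + z / y) * e ^ 2 ≠ 0 := by
    by_contra! hall
    have hne : ∀ r : K, (1 - Polynomial.C r * Polynomial.X ^ 2 : Polynomial K) ≠ 0 := by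
      intro r h
      simpa using congrArg (Polynomial.eval 0) h
    have h0 : (Polynomial.X * (1 - Polynomial.C (z / x) * Polynomial.X ^ 2) *
        (1 - Polynomial.C (z / x + z / y) * Polynomial.X ^ 2) : Polynomial K) = 0 := by
      refine Polynomial.funext fun e => ?_
      simp only [Polynomial.eval_mul, Polynomial.eval_sub, Polynomial.eval_one,
        Polynomial.eval_pow, Polynomial.eval_X, Polynomial.eval_C, Polynomial.eval_zero]
      by_cases h0 : e = 0
      · simp [h0]
      by_cases h1 : 1 - z / x * e ^ 2 = 0
      · simp [h1]
      rw [hall e h0 h1, mul_zero]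
    exact mul_ne_zero (mul_ne_zero Polynomial.X_ne_zero (hne _)) (hne _) h0
  obtain ⟨c, hc⟩ := IsAlgClosed.exists_pow_nat_eq (1 - z / x * e ^ 2) two_pos
  have hc0 : c ≠ 0 := fun h => h1 (by rw [← hc, h, zero_pow two_ne_zero])
  obtain ⟨d, hd⟩ := IsAlgClosed.exists_pow_nat_eq (1 - z / y * e ^ 2 / c ^ 2) two_pos
  have hd' : d ^ 2 * c ^ 2 = 1 - (z / x + z / y) * e ^ 2 := by
    rw [hd, sub_mul, div_mul_cancel₀ _ (pow_ne_zero 2 hc0), hc]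
    ring
  have hd0 : d ≠ 0 := fun h => h2 (by rw [← hd', h, zero_pow two_ne_zero, zero_mul])
  refine ⟨c, d, e, hc0, hd0, he, ?_, ?_⟩
  · rw [hc]
    field_simp
  · rw [mul_assoc, hd', hc]
    field_simp
    ring

theorem dominantFiniteOnOpens_of_isAlgClosed (hk : 1 ≤ k) (hkn : 2 * k ≤ n)
    (hn : n ≤ (k + 1).choose 2 + 1) (h2 : (2 : K) ≠ 0) :
    DominantFiniteOnOpens (ogrRing k ({1} : Set (Fin n → Kˣ))) (xsdRing K k n)
      (ogrToXsd k ({1} : Set (Fin n → Kˣ))) (2 ^ (n - 1)) := by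
  have : Infinite K := IsAlgClosed.instInfinite
  refine dominantFiniteOnOpens h2 hk (by omega) (isSignSystem_one K)
    (selfProjecting_inter_nonempty hk hkn) ?_
  rintro _ rfl
  refine exists_isUniqueForm_of_isSquare h2 hk (by omega) hn
    (exists_diagonalization_of_isAlgClosed K) 1
    ⟨fun a => ⟨a, by omega⟩, fun a b h => Fin.ext (by simpa using h)⟩
    ⟨fun a => ⟨k + a, by omega⟩, fun a b h => Fin.ext (by simpa using h)⟩ ?_ ?_ ?_
  · intro a b h
    have : (a : ℕ) = k + b := congrArg Fin.val h
    omega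
  · intro a
    simp
  · intro a
    exact IsAlgClosed.exists_eq_mul_self _

end AlgClosed

/-! ### The real numbers -/

section Real

variable {k n : ℕ}

/-- For `e ^ 2 = s` small enough, the required values of `c ^ 2` and `d ^ 2` are positive; `s` is
normalized so that the two perturbations have absolute values adding up to `1 / 4`. -/
theorem exists_diagonalization_real (x y z : ℝ) (hx : x ≠ 0) (hy : y ≠ 0) (hz : z ≠ 0) :
    ∃ c d e : ℝ, c ≠ 0 ∧ d ≠ 0 ∧ e ≠ 0 ∧
      x * c ^ 2 = x - z * e ^ 2 ∧ y * d ^ 2 * c ^ 2 = y * c ^ 2 - z * e ^ 2 := by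
  have hp : 0 < |z / x| := abs_pos.2 (div_ne_zero hz hx)
  have hq : 0 < |z / y| := abs_pos.2 (div_ne_zero hz hy)
  set s : ℝ := (4 * (|z / x| + |z / y|))⁻¹ with hs
  have hs0 : 0 < s := by positivity
  have hsum : |z / x| * s + |z / y| * s = 1 / 4 := by
    rw [hs]
    field_simp
  have hps : 0 < |z / x| * s := by positivity
  have hqs : 0 < |z / y| * s := by positivity
  have h1 : z / x * s ≤ |z / x| * s := mul_le_mul_of_nonneg_right (le_abs_self _) hs0.le
  have h2 : z / y * s ≤ |z / y| * s := mul_le_mul_of_nonneg_right (le_abs_self _) hs0.le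
  have hc : 1 / 2 < 1 - z / x * s := by linarith
  have hd : 0 < 1 - z / y * s / (1 - z / x * s) := by
    rw [sub_pos, div_lt_one (by linarith)]
    linarith
  refine ⟨√(1 - z / x * s), √(1 - z / y * s / (1 - z / x * s)), √s,
    (Real.sqrt_pos.2 (by linarith)).ne', (Real.sqrt_pos.2 hd).ne', (Real.sqrt_pos.2 hs0).ne', ?_, ?_⟩
  · rw [Real.sq_sqrt (by linarith), Real.sq_sqrt hs0.le]
    field_simp
  · have hc0 : 1 - z / x * s ≠ 0 := by linarith
    rw [Real.sq_sqrt hd.le, Real.sq_sqrt (by linarith : 0 ≤ 1 - z / x * s), Real.sq_sqrt hs0.le,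
      mul_assoc, sub_mul, div_mul_cancel₀ _ hc0]
    field_simp

/-- A larger `V` would contain a nonzero vector vanishing on `P`, and on such vectors the form is
negative definite. -/
theorem finrank_le_card_of_isotropic {u : Fin n → ℝ} {V : Submodule ℝ (Fin n → ℝ)}
    (hV : Isotropic u V) (P : Finset (Fin n)) (hP : ∀ i ∉ P, u i < 0) :
    Module.finrank ℝ V ≤ P.card := by
  by_contra! hlt
  set f : V →ₗ[ℝ] (P → ℝ) := (LinearMap.funLeft ℝ ℝ (Subtype.val : P → Fin n)).comp V.subtype
  have hker : LinearMap.ker f ≠ ⊥ := LinearMap.ker_ne_bot_of_finrank_lt (by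
    rwa [Module.finrank_fintype_fun_eq_card, Fintype.card_coe])
  obtain ⟨v, hv, hv0⟩ := (Submodule.ne_bot_iff _).1 hker
  have hvP : ∀ i ∈ P, (v : Fin n → ℝ) i = 0 := fun i hi => congrFun hv ⟨i, hi⟩
  have hle : ∀ i ∈ Finset.univ, 0 ≤ -(u i * (v : Fin n → ℝ) i * (v : Fin n → ℝ) i) := by
    intro i _
    by_cases hi : i ∈ P
    · simp [hvP i hi]
    · nlinarith [hP i hi, mul_self_nonneg ((v : Fin n → ℝ) i)]
  have hsum := hV v v.2 v v.2
  rw [← neg_eq_zero, ← Finset.sum_neg_distrib, Finset.sum_eq_zero_iff_of_nonneg hle] at hsum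
  apply hv0
  ext i
  by_cases hi : i ∈ P
  · exact hvP i hi
  · have := hsum i (Finset.mem_univ i)
    simpa [(hP i hi).ne] using this

/-- Up to squares a real form is its sign pattern; the common scalar is used to make the first sign
positive. -/
theorem isSignSystem_signVectors (hn : 0 < n) : IsSignSystem (signVectors n) where
  finite := by
    refine (Set.Finite.pi' (t := fun _ : Fin n => ({1, -1} : Set ℝˣ)) fun _ =>
      Set.toFinite _).subset fun u hu i => ?_
    simpa using hu.1 i
  sq_eq_one u hu i := by
    rcases hu.1 i with h | h <;> simp [h]
  exists_eq l := by
    set σ : ℝˣ → ℝˣ := fun x => if 0 < (x : ℝ) then 1 else -1 with hσ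
    have hσ1 : ∀ x, σ x = 1 ∨ σ x = -1 := fun x => by
      simp only [hσ]
      split_ifs <;> simp
    have hσm : ∀ x, σ x * σ x = 1 := fun x => by
      rcases hσ1 x with h | h <;> simp [h]
    have hσx : ∀ x : ℝˣ, (x : ℝ) = σ x * |(x : ℝ)| := fun x => by
      simp only [hσ]
      split_ifs with h
      · simp [abs_of_pos h]
      · simp [abs_of_nonpos (not_lt.1 h)]
    have ht : ∀ i, √|(l i : ℝ)| ≠ 0 := fun i =>
      (Real.sqrt_pos.2 (abs_pos.2 (l i).ne_zero)).ne'
    refine ⟨fun i => σ (l ⟨0, hn⟩) * σ (l i), ⟨fun i => ?_, fun i hi => ?_⟩, σ (l ⟨0, hn⟩),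
      fun i => Units.mk0 _ (ht i), fun i => Units.ext ?_⟩
    · rcases hσ1 (l ⟨0, hn⟩) with h | h <;> rcases hσ1 (l i) with h' | h' <;> simp [h, h']
    · have : i = ⟨0, hn⟩ := Fin.ext hi
      rw [this]
      exact hσm _
    · rw [← mul_assoc, hσm, one_mul, Units.val_mul, Units.val_pow_eq_pow_val, Units.val_mk0,
        Real.sq_sqrt (abs_nonneg _)]
      exact hσx _
  unique u hu u' hu' c t h := by
    have h' : ∀ i, (u' i : ℝ) = c * u i * (t i : ℝ) ^ 2 := fun i => by rw [h]; simp
    have hpos : ∀ i, 0 < (t i : ℝ) ^ 2 := fun i => by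
      have := (t i).ne_zero
      positivity
    have hc : 0 < (c : ℝ) := by
      have h0 := h' ⟨0, hn⟩
      rw [hu.2 _ rfl, hu'.2 _ rfl, Units.val_one, mul_one] at h0
      exact pos_of_mul_pos_left (by rw [← h0]; exact one_pos) (hpos _).le
    funext i
    have hi := h' i
    have hpi := mul_pos hc (hpos i)
    rcases hu.1 i with h1 | h1 <;> rcases hu'.1 i with h2 | h2 <;> rw [h1, h2] at hi ⊢ <;>
      · exfalso
        simp only [Units.val_one, Units.val_neg] at hi
        nlinarith

theorem dominantFiniteOnOpens_real (hk : 1 ≤ k) (hkn : 2 * k ≤ n)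
    (hn : n ≤ (k + 1).choose 2 + 1) :
    DominantFiniteOnOpens (ogrRing k (signVectors n)) (xsdRing ℝ k n)
      (ogrToXsd k (signVectors n)) (2 ^ (n - 1)) := by
  refine dominantFiniteOnOpens two_ne_zero hk (by omega) (isSignSystem_signVectors (by omega))
    (selfProjecting_inter_nonempty hk hkn) ?_
  rintro u hu ⟨V, hV⟩
  have hemb : ∀ P : Finset (Fin n), k ≤ P.card → ∃ α : Fin k ↪ Fin n, ∀ a, α a ∈ P := by
    intro P hP
    obtain ⟨α⟩ := Function.Embedding.nonempty_of_card_le (α := Fin k) (β := P)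
      (by rwa [Fintype.card_fin, Fintype.card_coe])
    exact ⟨α.trans (Function.Embedding.subtype _), fun a => (α a).2⟩
  classical
  -- Existence of an isotropic `V` forces at least `k` entries of each sign in `u`, as the starting
  -- configuration of `2k` vectors needs; sign vectors without isotropic subspaces contribute
  -- nothing to the union.
  obtain ⟨α, hα⟩ := hemb (Finset.univ.filter fun i => u i = 1) (by
    rw [← V.1.2]
    refine finrank_le_card_of_isotropic (mem_OGr_iff.1 hV) _ fun i hi => ?_
    simp only [Finset.mem_filter, Finset.mem_univ, true_and] at hi
    rw [(hu.1 i).resolve_left hi]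
    simp)
  obtain ⟨β, hβ⟩ := hemb (Finset.univ.filter fun i => u i = -1) (by
    rw [← V.1.2]
    have hV' := (isotropic_smul_iff (c := -1) (by norm_num)).2 (mem_OGr_iff.1 hV)
    refine finrank_le_card_of_isotropic hV' _ fun i hi => ?_
    simp only [Finset.mem_filter, Finset.mem_univ, true_and] at hi
    rw [(hu.1 i).resolve_right hi]
    simp)
  simp only [Finset.mem_filter, Finset.mem_univ, true_and] at hα hβ
  refine exists_isUniqueForm_of_isSquare two_ne_zero hk (by omega) hn exists_diagonalization_real u
    α β (fun a b h => ?_) (fun a => ?_) (fun a => ?_) ⟨V, hV⟩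
  · have h1 := hα a
    rw [h, hβ b] at h1
    have h2 := congrArg Units.val h1
    norm_num at h2
  · simp [hα]
  · simp [hβ]

end Real

end SelfProj

end

theorem mainTheorem11 (k n : ℕ) (hk : 1 ≤ k) (hkn : 2 * k ≤ n)
    (hn : n ≤ (k + 1).choose 2 + 1) :
    (∀ (K : Type*) [Field K] [IsAlgClosed K], (2 : K) ≠ 0 →
      SelfProj.DominantFiniteOnOpens
        (SelfProj.ogrRing k ({1} : Set (Fin n → Kˣ))) (SelfProj.xsdRing K k n)
        (SelfProj.ogrToXsd k ({1} : Set (Fin n → Kˣ))) (2 ^ (n - 1))) ∧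
    SelfProj.DominantFiniteOnOpens
      (SelfProj.ogrRing k (SelfProj.signVectors n)) (SelfProj.xsdRing ℝ k n)
      (SelfProj.ogrToXsd k (SelfProj.signVectors n)) (2 ^ (n - 1)) := by
  exact ⟨fun K _ _ h2 => SelfProj.dominantFiniteOnOpens_of_isAlgClosed K hk hkn hn h2,
    SelfProj.dominantFiniteOnOpens_real hk hkn hn⟩
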